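/- Let $\alpha>0$ and let $G^2_\alpha$ be the $\alpha$-Grushin plane, i.e. $\mathbb R^2$ with the horizontal vector fields $X=\partial_x$ and $Y_\alpha=|x|^\alpha\partial_y$ (and Lebesgue measure). For open $U\subset\mathbb R^2$ and $p\ge 1$, $HW^{1,p}(U)$ is the space of $u\in L^p(U)$ that have weak first partial derivatives on $U$ with $Xu,\,Y_\alpha u\in L^p(U)$. For open $\Omega,\Omega'$, a map $g=(g_1,g_2):\Omega\to\Omega'$ is in $HW^{1,p}_{\mathrm{loc}}(\Omega,\Omega')$ if $g_1,g_2\in HW^{1,p}(U)$ for every open $U$ with compact closure $\overline U\subset\Omega$. In what follows the partial derivatives are the usual ones, which exist almost everywhere for the maps considered. A map $g\in HW^{1,1}_{\mathrm{loc}}(\Omega,\Omega')$ is *orientation preserving* if $X(g_1)Y_\alpha(g_2)-Y_\alpha(g_1)X(g_2)>0$ a.e. in $\Omega$. A homeomorphism $g\in HW^{1,2}_{\mathrm{loc}}(\Omega,\Omega')$ of $\Omega$ onto $\Omega'$ is *conformal* if, with $S_g=\{(x,y)\in\Omega : x=0 \text{ or } g_1(x,y)=0\}$, $R_g=\Omega\setminus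 S_g$ and $$D_\alpha g=\begin{bmatrix} X(g_1) & Y_\alpha(g_1)\\ X(g_2)/|g_1|^\alpha & Y_\alpha(g_2)/|g_1|^\alpha\end{bmatrix},$$ (i) at almost every point of $R_g$ the matrix $D_\alpha g$ is a positive multiple of an orthogonal matrix, and (ii) for every $z_0\in S_g$ the limit of $D_\alpha g(z)$ as $R_g\ni z\to z_0$ exists, is finite and is not the zero matrix. Let $\mathcal C_\alpha$ denote the class of all orientation preserving conformal maps $g:\Omega\to\Omega'$ between open sets of $G^2_\alpha$ with $g\in HW^{1,2(\alpha+1)/\alpha}_{\mathrm{loc}}(\Omega,\Omega')$. **Corollary (Basic properties of Grushin-conformal mappings).** Let $g:\Omega_g\to\Omega_g'$ and $h:\Omega_h\to\Omega_h'$ belong to $\mathcal C_\alpha$. Then: 1. $g\circ h$ and $h\circ g$ belong to $\mathcal C_\alpha$, where $g\circ h$ is considered as a map from $\{z\in\Omega_h : h(z)\in\Omega_g\}$ onto its image, and similarly for $h\circ g$; 2. $g^{-1}:\Omega_g'\to\Omega_g$ and $h^{-1}:\Omega_h'\to\Omega_h$ belong to $\mathcal C_\alpha$. In particular, for every $\lambda>0$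 and the dilation $\delta_\lambda(x,y)=(\lambda x,\lambda^{\alpha+1}y)$, the maps $g\circ\delta_\lambda:\delta_\lambda^{-1}(\Omega_g)\to\Omega_g'$ and $\delta_\lambda\circ g:\Omega_g\to\delta_\lambda(\Omega_g')$ belong to $\mathcal C_\alpha$; in particular they are conformal. -/

import Mathlib

open MeasureTheory Filter Topology
open scoped ContDiff

/-!
The `α`-Grushin plane is modelled on `ℝ × ℝ` with its usual topology (which is also the topology of
the Carnot–Carathéodory distance) and Lebesgue measure.
-/

namespace Grushin

noncomputable section

/-- `v` is the weak derivative of `u` in the direction `e` on the open set `U`. -/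
def HasWeakDerivOn (U : Set (ℝ × ℝ)) (e : ℝ × ℝ) (u v : ℝ × ℝ → ℝ) : Prop :=
  LocallyIntegrableOn u U ∧ LocallyIntegrableOn v U ∧
    ∀ φ : ℝ × ℝ → ℝ, ContDiff ℝ ∞ φ → HasCompactSupport φ → tsupport φ ⊆ U →
      ∫ p in U, u p * fderiv ℝ φ p e = -∫ p in U, v p * φ p

/-- The horizontal Sobolev space `HW^{1,p}(U)`: `u ∈ L^p(U)` has weak partial derivatives
`∂u/∂x`, `∂u/∂y`, and `(∂u/∂x, |x|^α ∂u/∂y) ∈ L^p(U)`. -/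
def MemHW (α : ℝ) (p : ENNReal) (U : Set (ℝ × ℝ)) (u : ℝ × ℝ → ℝ) : Prop :=
  MemLp u p (volume.restrict U) ∧
    ∃ ux uy : ℝ × ℝ → ℝ,
      HasWeakDerivOn U (1, 0) u ux ∧ HasWeakDerivOn U (0, 1) u uy ∧
      MemLp ux p (volume.restrict U) ∧
      MemLp (fun z => |z.1| ^ α * uy z) p (volume.restrict U)

/-- The horizontal Sobolev space of mappings `HW^{1,p}(U, Ω')`. -/
def MemHWMap (α : ℝ) (p : ENNReal) (U Ω' : Set (ℝ × ℝ)) (f : ℝ × ℝ → ℝ × ℝ) : Prop :=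
  Set.MapsTo f U Ω' ∧ MemHW α p U (fun z => (f z).1) ∧ MemHW α p U (fun z => (f z).2)

/-- The local horizontal Sobolev space of mappings `HW^{1,p}_loc(Ω, Ω')`: membership in
`HW^{1,p}(U, Ω')` for every open `U` whose closure is a compact subset of `Ω`. -/
def MemHWLocMap (α : ℝ) (p : ENNReal) (Ω Ω' : Set (ℝ × ℝ)) (f : ℝ × ℝ → ℝ × ℝ) : Prop :=
  Set.MapsTo f Ω Ω' ∧
    ∀ U : Set (ℝ × ℝ), IsOpen U → IsCompact (closure U) → closure U ⊆ Ω → MemHWMap α p U Ω' f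

/-- `X u = ∂u/∂x`, with the usual (pointwise) partial derivative. -/
def X (u : ℝ × ℝ → ℝ) (z : ℝ × ℝ) : ℝ :=
  deriv (fun t => u (t, z.2)) z.1

/-- `Y_α u = |x|^α ∂u/∂y`, with the usual (pointwise) partial derivative. -/
def Y (α : ℝ) (u : ℝ × ℝ → ℝ) (z : ℝ × ℝ) : ℝ :=
  |z.1| ^ α * deriv (fun t => u (z.1, t)) z.2

/-- The matrix `D_H f`. -/
def DH (α : ℝ) (f : ℝ × ℝ → ℝ × ℝ) (z : ℝ × ℝ) : Matrix (Fin 2) (Fin 2) ℝ :=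
  !![X (fun w => (f w).1) z, Y α (fun w => (f w).1) z;
     X (fun w => (f w).2) z, Y α (fun w => (f w).2) z]

/-- The matrix `D_α f`: the second row of `D_H f` is divided by `|f₁|^α`. -/
def Dα (α : ℝ) (f : ℝ × ℝ → ℝ × ℝ) (z : ℝ × ℝ) : Matrix (Fin 2) (Fin 2) ℝ :=
  !![X (fun w => (f w).1) z, Y α (fun w => (f w).1) z;
     X (fun w => (f w).2) z / |(f z).1| ^ α, Y α (fun w => (f w).2) z / |(f z).1| ^ α]

/-- The singular set `S_f` of `f : Ω → ℝ²`. -/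
def singularSet (Ω : Set (ℝ × ℝ)) (f : ℝ × ℝ → ℝ × ℝ) : Set (ℝ × ℝ) :=
  {z ∈ Ω | z.1 = 0 ∨ (f z).1 = 0}

/-- The regular set `R_f` of `f : Ω → ℝ²`. -/
def regularSet (Ω : Set (ℝ × ℝ)) (f : ℝ × ℝ → ℝ × ℝ) : Set (ℝ × ℝ) :=
  Ω \ singularSet Ω f

/-- A Sobolev map is orientation preserving if `det D_H f > 0` almost everywhere. -/
def OrientationPreserving (α : ℝ) (Ω Ω' : Set (ℝ × ℝ)) (f : ℝ × ℝ → ℝ × ℝ) : Prop :=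
  MemHWLocMap α 1 Ω Ω' f ∧ ∀ᵐ z ∂(volume.restrict Ω), 0 < (DH α f z).det

/-- A homeomorphism `g` between the open sets `g.source` and `g.target` is conformal in the
Grushin plane. -/
def IsConformal (α : ℝ) (g : OpenPartialHomeomorph (ℝ × ℝ) (ℝ × ℝ)) : Prop :=
  MemHWLocMap α 2 g.source g.target g ∧
    (∀ᵐ z ∂(volume.restrict (regularSet g.source g)),
      ∃ c : ℝ, 0 < c ∧ ∃ O ∈ Matrix.orthogonalGroup (Fin 2) ℝ, Dα α g z = c • O) ∧
    ∀ z₀ ∈ singularSet g.source g,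
      ∃ L : Matrix (Fin 2) (Fin 2) ℝ, L ≠ 0 ∧
        Tendsto (Dα α g) (𝓝[regularSet g.source g] z₀) (𝓝 L)

/-- `g` is an orientation preserving conformal map of class `HW^{1, 2(α+1)/α}_loc`. -/
def IsSobolevConformal (α : ℝ) (g : OpenPartialHomeomorph (ℝ × ℝ) (ℝ × ℝ)) : Prop :=
  OrientationPreserving α g.source g.target g ∧ IsConformal α g ∧
    MemHWLocMap α (ENNReal.ofReal (2 * (α + 1) / α)) g.source g.target g

/-- The dilation `δ_r (x, y) = (r x, r^(α+1) y)`, `r > 0`. -/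
def dilation (α r : ℝ) (hr : 0 < r) : (ℝ × ℝ) ≃ₜ (ℝ × ℝ) where
  toFun z := (r * z.1, r ^ (α + 1) * z.2)
  invFun z := (r⁻¹ * z.1, (r ^ (α + 1))⁻¹ * z.2)
  left_inv z := by
    have h : r ^ (α + 1) ≠ 0 := (Real.rpow_pos_of_pos hr _).ne'
    ext <;> simp [hr.ne', h]
  right_inv z := by
    have h : r ^ (α + 1) ≠ 0 := (Real.rpow_pos_of_pos hr _).ne'
    ext <;> simp [hr.ne', h]
  continuous_toFun := by fun_prop
  continuous_invFun := by fun_prop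

end

end Grushin

/-!
Since `|x| ^ α` is the derivative of `x |x| ^ α / (α + 1)`, the homeomorphism
`Φ (x, y) = x |x| ^ α / (α + 1) + i y` of the Grushin plane onto `ℂ` turns the horizontal
Cauchy–Riemann equations into the classical ones. A homeomorphism `g` lies in the class `C_α` if and
only if `F = Φ ∘ g ∘ Φ⁻¹` is holomorphic and `g` maps the line `x = 0`, and nothing else, into
itself; this condition is visibly stable under composition and inversion, and it holds for the
dilations, for which `F` is multiplication by `r ^ (α + 1)`.

If `g` lies in `C_α`, its components are absolutely continuous on almost every line, so that the
pointwise partial derivatives are weak ones. The orthogonality of `Dα α g` and the orientation give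
the Cauchy–Riemann equations almost everywhere; the zero set of `g₁` does no harm, because the
derivatives of `g₁` vanish almost everywhere on it, so that it is null by `det (DH α g) > 0`.
Integrating over rectangles, Morera's theorem applies to `F`. Being injective, `F` has a nowhere
vanishing derivative, and letting `z → z₀` in `|g₁| ^ α • Dα α g = |x| ^ α • F'` shows that `g₁` and
`x` have the same zeros.

Conversely, `g` is smooth off the line `x = 0`. On the line `F'` is real, so that
`Re F (w) / Re w → F'` and `Im F' = O(Re w)` there: the first makes `|x| ^ α / |g₁| ^ α` extend to a
continuous positive function, the second makes `∂g₁/∂y` tend to `0`. Hence `g` has continuous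
partial derivatives and belongs to every local horizontal Sobolev space.
-/

namespace Grushin

open Set

section SmoothStep

variable {N p q : ℝ} {w v : ℝ → ℝ}

lemma contDiff_smoothTransition : ContDiff ℝ ∞ Real.smoothTransition :=
  Real.smoothTransition.contDiff (n := ⊤)

lemma continuous_deriv_smoothTransition : Continuous (deriv Real.smoothTransition) :=
  contDiff_smoothTransition.continuous_deriv (by simp)

lemma support_deriv_smoothTransition_subset :
    Function.support (deriv Real.smoothTransition) ⊆ Ioo 0 1 := by
  refine fun s hs => ⟨not_le.1 fun h => hs ?_, not_le.1 fun h => hs ?_⟩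
  · exact IsLocalMin.deriv_eq_zero (.of_forall fun x =>
      (Real.smoothTransition.zero_of_nonpos h).trans_le (Real.smoothTransition.nonneg x))
  · exact IsLocalMax.deriv_eq_zero (.of_forall fun x =>
      (Real.smoothTransition.le_one x).trans_eq (Real.smoothTransition.one_of_one_le h).symm)

/-- A smooth step of steepness `N` at `p`: it increases from `0` to `1` on `[p, p + 1 / N]`. -/
noncomputable def smoothStep (N p x : ℝ) : ℝ :=
  Real.smoothTransition (N * (x - p))

lemma contDiff_smoothStep (N p : ℝ) : ContDiff ℝ ∞ (smoothStep N p) :=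
  contDiff_smoothTransition.comp (by fun_prop)

lemma continuous_deriv_smoothStep (N p : ℝ) : Continuous (deriv (smoothStep N p)) :=
  (contDiff_smoothStep N p).continuous_deriv (by simp)

lemma deriv_smoothStep (N p x : ℝ) :
    deriv (smoothStep N p) x = N * deriv Real.smoothTransition (N * (x - p)) := by
  have hinner : HasDerivAt (fun x => N * (x - p)) N x := by
    simpa using ((hasDerivAt_id x).sub_const p).const_mul N
  have houter := (contDiff_smoothTransition.differentiable (by simp) (N * (x - p))).hasDerivAt
  exact (houter.comp x hinner).deriv.trans (mul_comm _ _)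

lemma smoothStep_of_le (hN : 0 < N) {x : ℝ} (hx : x ≤ p) : smoothStep N p x = 0 :=
  Real.smoothTransition.zero_of_nonpos
    (mul_nonpos_of_nonneg_of_nonpos hN.le (sub_nonpos.2 hx))

lemma smoothStep_of_ge (hN : 0 < N) {x : ℝ} (hx : p + 1 / N ≤ x) : smoothStep N p x = 1 :=
  Real.smoothTransition.one_of_one_le
    ((div_le_iff₀' hN).1 (le_sub_iff_add_le'.2 hx))

lemma support_deriv_smoothStep_subset (hN : 0 < N) :
    Function.support (deriv (smoothStep N p)) ⊆ Icc p (p + 1 / N) := by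
  intro x hx
  rw [Function.mem_support, deriv_smoothStep] at hx
  obtain ⟨h0, h1⟩ := support_deriv_smoothTransition_subset (right_ne_zero_of_mul hx)
  exact ⟨(sub_pos.1 (pos_of_mul_pos_right h0 hN.le)).le,
    sub_le_iff_le_add'.1 ((le_div_iff₀' hN).2 h1.le)⟩

lemma integrable_mul_deriv_smoothStep (hw : Continuous w) (hN : 0 < N) :
    Integrable fun x => w x * deriv (smoothStep N p) x :=
  (hw.mul (continuous_deriv_smoothStep N p)).integrable_of_hasCompactSupport <|
    HasCompactSupport.intro (isCompact_Icc (a := p) (b := p + 1 / N)) fun x hx => by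
      rw [Pi.mul_apply,
        Function.notMem_support.1 fun h => hx (support_deriv_smoothStep_subset hN h), mul_zero]

lemma integral_mul_deriv_smoothStep (w : ℝ → ℝ) (hN : 0 < N) :
    ∫ x, w x * deriv (smoothStep N p) x =
      ∫ s in (0 : ℝ)..1, w (p + s * (1 / N)) * deriv Real.smoothTransition s := by
  let m : ℝ → ℝ := fun s => w (p + s * (1 / N)) * deriv Real.smoothTransition s
  calc ∫ x, w x * deriv (smoothStep N p) x
      = ∫ x, N * m (N * (x - p)) := by
        refine integral_congr_ae (.of_forall fun x => ?_)
        have hx : p + N * (x - p) * (1 / N) = x := by field_simp; ring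
        simp only [m, hx, deriv_smoothStep]
        ring
    _ = ∫ s, m s := by
        rw [integral_const_mul, integral_sub_right_eq_self (fun t => m (N * t)) p,
          Measure.integral_comp_mul_left, abs_of_pos (inv_pos.2 hN), smul_eq_mul,
          mul_inv_cancel_left₀ hN.ne']
    _ = ∫ s in (0 : ℝ)..1, m s :=
        (intervalIntegral.integral_eq_integral_of_support_subset <|
          (Function.support_mul_subset_right _ _).trans <|
            support_deriv_smoothTransition_subset.trans Ioo_subset_Ioc_self).symm

lemma tendsto_integral_mul_deriv_smoothStep (hw : Continuous w) (p : ℝ) :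
    Tendsto (fun n : ℕ => ∫ x, w x * deriv (smoothStep (n + 1) p) x) atTop (𝓝 (w p)) := by
  let G : ℝ → ℝ := fun ε => ∫ s in (0 : ℝ)..1, w (p + s * ε) * deriv Real.smoothTransition s
  have hG : Continuous G := by
    have := continuous_deriv_smoothTransition
    apply intervalIntegral.continuous_parametric_intervalIntegral_of_continuous'
    fun_prop
  have hG0 : G 0 = w p := by
    simp only [G, mul_zero, add_zero]
    rw [intervalIntegral.integral_const_mul, intervalIntegral.integral_deriv_eq_sub
        (fun x _ => contDiff_smoothTransition.differentiable (by simp) x)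
        (continuous_deriv_smoothTransition.intervalIntegrable _ _),
      Real.smoothTransition.one, Real.smoothTransition.zero, sub_zero, mul_one]
  rw [← hG0]
  exact ((hG.tendsto 0).comp tendsto_one_div_add_atTop_nhds_zero_nat).congr fun n =>
    (integral_mul_deriv_smoothStep w (by positivity)).symm

lemma tendsto_smoothStep (p x : ℝ) :
    Tendsto (fun n : ℕ => smoothStep (n + 1) p x) atTop (𝓝 ((Ioi p).indicator 1 x)) := by
  by_cases hx : p < x
  · rw [indicator_of_mem (mem_Ioi.2 hx)]
    have hlim : Tendsto (fun n : ℕ => p + 1 / ((n : ℝ) + 1)) atTop (𝓝 (p + 0)) :=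
      tendsto_one_div_add_atTop_nhds_zero_nat.const_add p
    rw [add_zero] at hlim
    refine tendsto_const_nhds.congr' ?_
    filter_upwards [hlim.eventually_le_const hx] with n hn
    exact (smoothStep_of_ge (by positivity) hn).symm
  · rw [indicator_of_notMem (notMem_Ioi.2 (not_lt.1 hx))]
    exact tendsto_const_nhds.congr fun n =>
      (smoothStep_of_le (by positivity) (not_lt.1 hx)).symm

/-- A smooth approximation of the indicator function of `(p, q]`, of steepness `N`. -/
noncomputable def smoothCutoff (N p q : ℝ) : ℝ → ℝ :=
  smoothStep N p - smoothStep N q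

lemma contDiff_smoothCutoff (N p q : ℝ) : ContDiff ℝ ∞ (smoothCutoff N p q) :=
  (contDiff_smoothStep N p).sub (contDiff_smoothStep N q)

lemma deriv_smoothCutoff (N p q x : ℝ) :
    deriv (smoothCutoff N p q) x = deriv (smoothStep N p) x - deriv (smoothStep N q) x :=
  deriv_sub ((contDiff_smoothStep N p).differentiable (by simp) x)
    ((contDiff_smoothStep N q).differentiable (by simp) x)

lemma abs_smoothCutoff_le_one (N p q x : ℝ) : |smoothCutoff N p q x| ≤ 1 :=
  abs_sub_le_of_nonneg_of_le (Real.smoothTransition.nonneg _) (Real.smoothTransition.le_one _)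
    (Real.smoothTransition.nonneg _) (Real.smoothTransition.le_one _)

lemma tsupport_smoothCutoff_subset (hN : 0 < N) (hpq : p ≤ q) :
    tsupport (smoothCutoff N p q) ⊆ Icc p (q + 1 / N) := by
  refine closure_minimal (fun x hx => ⟨not_lt.1 fun h => hx ?_, not_lt.1 fun h => hx ?_⟩)
    isClosed_Icc
  · simp only [smoothCutoff, Pi.sub_apply, smoothStep_of_le hN h.le,
      smoothStep_of_le hN (h.le.trans hpq), sub_self]
  · simp only [smoothCutoff, Pi.sub_apply, smoothStep_of_ge hN h.le,
      smoothStep_of_ge hN ((add_le_add_left hpq _).trans h.le), sub_self]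

lemma tendsto_smoothCutoff (hpq : p ≤ q) (x : ℝ) :
    Tendsto (fun n : ℕ => smoothCutoff (n + 1) p q x) atTop (𝓝 ((Ioc p q).indicator 1 x)) := by
  rw [← Ioi_sdiff_Ioi, indicator_sdiff (Ioi_subset_Ioi hpq)]
  exact (tendsto_smoothStep p x).sub (tendsto_smoothStep q x)

lemma tendsto_integral_mul_deriv_smoothCutoff (hw : Continuous w) (p q : ℝ) :
    Tendsto (fun n : ℕ => ∫ x, w x * deriv (smoothCutoff (n + 1) p q) x)
      atTop (𝓝 (w p - w q)) := by
  refine ((tendsto_integral_mul_deriv_smoothStep hw p).sub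
    (tendsto_integral_mul_deriv_smoothStep hw q)).congr fun n => ?_
  rw [← integral_sub (integrable_mul_deriv_smoothStep hw (by positivity))
    (integrable_mul_deriv_smoothStep hw (by positivity))]
  simp only [deriv_smoothCutoff, mul_sub]

lemma tendsto_setIntegral_mul_smoothCutoff {s : Set ℝ}
    (hv : IntegrableOn v s) (hpq : p ≤ q) (hpqs : Ioc p q ⊆ s) :
    Tendsto (fun n : ℕ => ∫ x in s, v x * smoothCutoff (n + 1) p q x)
      atTop (𝓝 (∫ x in p..q, v x)) := by
  have hlimit : ∫ x in p..q, v x = ∫ x in s, v x * (Ioc p q).indicator 1 x := by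
    simp only [← indicator_mul_right, Pi.one_apply, mul_one]
    rw [intervalIntegral.integral_of_le hpq, setIntegral_indicator measurableSet_Ioc,
      inter_eq_right.2 hpqs]
  rw [hlimit]
  apply tendsto_integral_of_dominated_convergence (fun x => |v x|)
  · exact fun n =>
      hv.aestronglyMeasurable.mul (contDiff_smoothCutoff _ p q).continuous.aestronglyMeasurable
  · exact hv.abs
  · refine fun n => .of_forall fun x => ?_
    rw [Real.norm_eq_abs, abs_mul]
    exact mul_le_of_le_one_right (abs_nonneg _) (abs_smoothCutoff_le_one _ _ _ _)
  · exact .of_forall fun x => (tendsto_smoothCutoff hpq x).const_mul _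

lemma sub_eq_integral_of_forall_smoothCutoff (hw : Continuous w) {a b : ℝ}
    (hv : IntegrableOn v (Ioo a b)) (hap : a < p) (hpq : p ≤ q) (hqb : q < b)
    (h : ∀ n : ℕ, q + 1 / ((n : ℝ) + 1) < b →
      ∫ x in Ioo a b, w x * deriv (smoothCutoff (n + 1) p q) x =
        -∫ x in Ioo a b, v x * smoothCutoff (n + 1) p q x) :
    w q - w p = ∫ x in p..q, v x := by
  have hsmall : ∀ᶠ n : ℕ in atTop, q + 1 / ((n : ℝ) + 1) < b := by
    have hlim : Tendsto (fun n : ℕ => q + 1 / ((n : ℝ) + 1)) atTop (𝓝 (q + 0)) :=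
      tendsto_one_div_add_atTop_nhds_zero_nat.const_add q
    rw [add_zero] at hlim
    exact hlim.eventually_lt_const hqb
  have hv_lim := (tendsto_setIntegral_mul_smoothCutoff hv hpq
    fun x hx => ⟨hap.trans hx.1, hx.2.trans_lt hqb⟩).neg
  have hw_lim : Tendsto (fun n : ℕ => -∫ x in Ioo a b, v x * smoothCutoff (n + 1) p q x)
      atTop (𝓝 (w p - w q)) := by
    refine (tendsto_integral_mul_deriv_smoothCutoff hw p q).congr' ?_
    filter_upwards [hsmall] with n hn
    rw [← h n hn, setIntegral_eq_integral_of_forall_compl_eq_zero]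
    intro x hx
    have hxs : x ∉ Function.support (deriv (smoothCutoff (n + 1) p q)) := fun hx' =>
      have hmem := tsupport_smoothCutoff_subset (by positivity) hpq (support_deriv_subset hx')
      hx ⟨hap.trans_le hmem.1, hmem.2.trans_lt hn⟩
    rw [Function.notMem_support.1 hxs, mul_zero]
  linarith [tendsto_nhds_unique hw_lim hv_lim]

lemma sub_eq_integral_of_forall_rat {a b : ℝ} (hab : a < b) (hw : ContinuousOn w (Icc a b))
    (hv : IntervalIntegrable v volume a b)
    (h : ∀ p q : ℚ, a < p → (p : ℝ) ≤ q → q < b → w q - w p = ∫ x in p..q, v x) :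
    ∀ x ∈ Icc a b, w x - w a = ∫ t in a..x, v t := by
  have hint {r : ℝ} (hr : r ∈ Icc a b) : IntervalIntegrable v volume a r :=
    hv.mono_set (uIcc_subset_uIcc_left (by rwa [uIcc_of_le hab.le]))
  let D : ℝ → ℝ := fun x => w x - ∫ t in a..x, v t
  have hD : ContinuousOn D (Icc a b) := by
    have hprim := intervalIntegral.continuousOn_primitive_interval' hv left_mem_uIcc
    rw [uIcc_of_le hab.le] at hprim
    exact hw.sub hprim
  have hD_rat (p q : ℚ) (hp : a < p) (hpq : (p : ℝ) ≤ q) (hq : q < b) : D q = D p := by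
    have hsub := intervalIntegral.integral_interval_sub_left
      (hint ⟨hp.le.trans hpq, hq.le⟩) (hint ⟨hp.le, hpq.trans hq.le⟩)
    have := h p q hp hpq hq
    simp only [D]
    linarith
  obtain ⟨r, har, hrb⟩ := exists_rat_btwn hab
  have hdense : Icc a b ⊆ closure (Ioo a b ∩ range ((↑) : ℚ → ℝ)) := by
    rw [← closure_Ioo hab.ne]
    exact closure_minimal
      (Rat.isDenseEmbedding_coe_real.dense.open_subset_closure_inter isOpen_Ioo) isClosed_closure
  have hconst : EqOn D (fun _ => D r) (Icc a b) := by
    refine EqOn.of_subset_closure ?_ hD continuousOn_const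
      (inter_subset_left.trans Ioo_subset_Icc_self) hdense
    rintro _ ⟨hs, s, rfl⟩
    rcases le_total (r : ℝ) s with hrs | hsr
    · exact hD_rat r s har hrs hs.2
    · exact (hD_rat s r hs.1 hsr hrb).symm
  intro x hx
  have := (hconst hx).trans (hconst (left_mem_Icc.2 hab.le)).symm
  simp only [D, intervalIntegral.integral_same] at this
  linarith

end SmoothStep

section WeakDerivative

variable {U V : Set (ℝ × ℝ)} {e : ℝ × ℝ} {u u' v : ℝ × ℝ → ℝ} {a b c d : ℝ} {A B : ℝ → ℝ}

lemma volume_restrict_prod (s t : Set ℝ) :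
    (volume : Measure (ℝ × ℝ)).restrict (s ×ˢ t) =
      (volume.restrict s).prod (volume.restrict t) := by
  rw [Measure.prod_restrict, ← Measure.volume_eq_prod]

lemma HasWeakDerivOn.congr (hU : MeasurableSet U) (h : HasWeakDerivOn U e u v)
    (huu' : EqOn u u' U) : HasWeakDerivOn U e u' v := by
  refine ⟨h.1.congr (ae_restrict_of_forall_mem hU huu'), h.2.1, fun φ hφ hφc hφU => ?_⟩
  rw [← h.2.2 φ hφ hφc hφU]
  exact setIntegral_congr_fun hU fun z hz => by simp only [huu' hz]

lemma setIntegral_mul_eq_integral_of_tsupport_subset {φ : ℝ × ℝ → ℝ} (hφU : tsupport φ ⊆ U) :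
    ∫ z in U, u z * φ z = ∫ z, u z * φ z :=
  setIntegral_eq_integral_of_forall_compl_eq_zero fun z hz => by
    rw [image_eq_zero_of_notMem_tsupport fun h => hz (hφU h), mul_zero]

lemma HasWeakDerivOn.mono (h : HasWeakDerivOn U e u v) (hVU : V ⊆ U) :
    HasWeakDerivOn V e u v := by
  refine ⟨h.1.mono_set hVU, h.2.1.mono_set hVU, fun φ hφ hφc hφV => ?_⟩
  have hU := h.2.2 φ hφ hφc (hφV.trans hVU)
  have hφ'V : tsupport (fun z => fderiv ℝ φ z e) ⊆ V :=
    (tsupport_fderiv_apply_subset ℝ e).trans hφV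
  rwa [setIntegral_mul_eq_integral_of_tsupport_subset (hφV.trans hVU),
    setIntegral_mul_eq_integral_of_tsupport_subset (hφ'V.trans hVU),
    ← setIntegral_mul_eq_integral_of_tsupport_subset hφV,
    ← setIntegral_mul_eq_integral_of_tsupport_subset hφ'V] at hU

lemma tsupport_mul_prod_subset (A B : ℝ → ℝ) :
    tsupport (fun z : ℝ × ℝ => A z.1 * B z.2) ⊆ tsupport A ×ˢ tsupport B :=
  closure_minimal
    (fun _ hz => ⟨subset_tsupport _ (left_ne_zero_of_mul hz),
      subset_tsupport _ (right_ne_zero_of_mul hz)⟩)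
    ((isClosed_tsupport A).prod (isClosed_tsupport B))

lemma fderiv_mul_prod_apply_one_zero (hA : Differentiable ℝ A) (hB : Differentiable ℝ B)
    (z : ℝ × ℝ) :
    fderiv ℝ (fun z : ℝ × ℝ => A z.1 * B z.2) z (1, 0) = deriv A z.1 * B z.2 := by
  have hA' := (hA z.1).hasDerivAt.comp_hasFDerivAt z (hasFDerivAt_fst (𝕜 := ℝ))
  have hB' := (hB z.2).hasDerivAt.comp_hasFDerivAt z (hasFDerivAt_snd (𝕜 := ℝ))
  have hAB : HasFDerivAt (fun z : ℝ × ℝ => A z.1 * B z.2) _ z := hA'.mul hB'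
  rw [hAB.fderiv]
  simp [mul_comm]

lemma HasWeakDerivOn.setIntegral_mul_deriv_mul {s t : Set ℝ}
    (h : HasWeakDerivOn (s ×ˢ t) (1, 0) u v)
    (hA : ContDiff ℝ ∞ A) (hAc : HasCompactSupport A) (hAs : tsupport A ⊆ s)
    (hB : ContDiff ℝ ∞ B) (hBc : HasCompactSupport B) (hBt : tsupport B ⊆ t) :
    ∫ z in s ×ˢ t, u z * (deriv A z.1 * B z.2) = -∫ z in s ×ˢ t, v z * (A z.1 * B z.2) := by
  have hsub := tsupport_mul_prod_subset A B
  have hweak := h.2.2 (fun z => A z.1 * B z.2) ((hA.comp contDiff_fst).mul (hB.comp contDiff_snd))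
    ((hAc.isCompact.prod hBc.isCompact).of_isClosed_subset (isClosed_tsupport _) hsub)
    (hsub.trans (prod_mono hAs hBt))
  simpa only [fderiv_mul_prod_apply_one_zero (hA.differentiable (by simp))
    (hB.differentiable (by simp))] using hweak

lemma integrableOn_Ioo_prod_Ioo (hu : Continuous u) : IntegrableOn u (Ioo a b ×ˢ Ioo c d) :=
  (hu.continuousOn.integrableOn_compact (isCompact_Icc.prod isCompact_Icc)).mono_set
    (prod_mono Ioo_subset_Icc_self Ioo_subset_Icc_self)

lemma HasWeakDerivOn.ae_setIntegral_mul_deriv (hu : Continuous u)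
    (h : HasWeakDerivOn (Ioo a b ×ˢ Ioo c d) (1, 0) u v)
    (hv : IntegrableOn v (Ioo a b ×ˢ Ioo c d)) (hA : ContDiff ℝ ∞ A)
    (hAs : tsupport A ⊆ Ioo a b) :
    ∀ᵐ y, y ∈ Ioo c d →
      ∫ x in Ioo a b, (u (x, y) * deriv A x + v (x, y) * A x) = 0 := by
  have hAc : HasCompactSupport A :=
    isCompact_Icc.of_isClosed_subset (isClosed_tsupport A) (hAs.trans Ioo_subset_Icc_self)
  have hA' : Continuous (deriv A) := hA.continuous_deriv (by simp)
  obtain ⟨C, hC⟩ := hA.continuous.bounded_above_of_compact_support hAc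
  have huA : IntegrableOn (fun z : ℝ × ℝ => u z * deriv A z.1) (Ioo a b ×ˢ Ioo c d) :=
    integrableOn_Ioo_prod_Ioo (by fun_prop)
  have hvA : IntegrableOn (fun z : ℝ × ℝ => v z * A z.1) (Ioo a b ×ˢ Ioo c d) :=
    hv.mul_bdd (hA.continuous.comp continuous_fst).aestronglyMeasurable
      (.of_forall fun z => hC z.1)
  have hsum := huA.add hvA
  rw [IntegrableOn, volume_restrict_prod] at hsum
  apply isOpen_Ioo.ae_eq_zero_of_integral_contDiff_smul_eq_zero
    (IntegrableOn.locallyIntegrableOn hsum.integral_prod_right)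
  intro B hB hBc hBt
  obtain ⟨C', hC'⟩ := hB.continuous.bounded_above_of_compact_support hBc
  have hbdd {w : ℝ × ℝ → ℝ} (hw : IntegrableOn w (Ioo a b ×ˢ Ioo c d)) :
      IntegrableOn (fun z => w z * B z.2) (Ioo a b ×ˢ Ioo c d) := by
    have hB' : Continuous fun z : ℝ × ℝ => B z.2 := hB.continuous.comp continuous_snd
    exact hw.mul_bdd hB'.aestronglyMeasurable (.of_forall fun z => hC' z.2)
  have hsumB := (hbdd huA).add (hbdd hvA)
  rw [IntegrableOn, volume_restrict_prod] at hsumB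
  calc ∫ y, B y • ∫ x in Ioo a b, (u (x, y) * deriv A x + v (x, y) * A x)
      = ∫ y in Ioo c d, B y • ∫ x in Ioo a b, (u (x, y) * deriv A x + v (x, y) * A x) :=
        (setIntegral_eq_integral_of_forall_compl_eq_zero fun y hy => by
          rw [image_eq_zero_of_notMem_tsupport fun hy' => hy (hBt hy'), zero_smul]).symm
    _ = ∫ y in Ioo c d, ∫ x in Ioo a b,
          (u (x, y) * deriv A x * B y + v (x, y) * A x * B y) := by
        simp only [← add_mul, integral_mul_const, smul_eq_mul, mul_comm (B _)]
    _ = ∫ z in Ioo a b ×ˢ Ioo c d, (u z * deriv A z.1 * B z.2 + v z * A z.1 * B z.2) := by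
        rw [volume_restrict_prod]
        exact (integral_prod_symm _ hsumB).symm
    _ = 0 := by
        rw [integral_add (hbdd huA) (hbdd hvA)]
        simp only [mul_assoc]
        rw [h.setIntegral_mul_deriv_mul hA hAc hAs hB hBc hBt, neg_add_cancel]

theorem HasWeakDerivOn.ae_sub_eq_integral (hab : a < b) (hu : Continuous u)
    (h : HasWeakDerivOn (Ioo a b ×ˢ Ioo c d) (1, 0) u v)
    (hv : IntegrableOn v (Ioo a b ×ˢ Ioo c d)) :
    ∀ᵐ y, y ∈ Ioo c d → IntervalIntegrable (fun x => v (x, y)) volume a b ∧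
      ∀ x ∈ Icc a b, u (x, y) - u (a, y) = ∫ t in a..x, v (t, y) := by
  have hslice : ∀ᵐ y, y ∈ Ioo c d → IntegrableOn (fun x => v (x, y)) (Ioo a b) := by
    rw [IntegrableOn, volume_restrict_prod] at hv
    exact (ae_restrict_iff' measurableSet_Ioo).1 hv.prod_left_ae
  -- Rational endpoints and integer steepness leave countably many exceptional null sets.
  have hcutoff : ∀ᵐ y, ∀ p q : ℚ, ∀ n : ℕ, a < p → (p : ℝ) ≤ q → q + 1 / ((n : ℝ) + 1) < b →
      y ∈ Ioo c d → ∫ x in Ioo a b, (u (x, y) * deriv (smoothCutoff (n + 1) p q) x +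
        v (x, y) * smoothCutoff (n + 1) p q x) = 0 := by
    simp only [ae_all_iff]
    intro p q n hap hpq hqb
    exact h.ae_setIntegral_mul_deriv hu hv (contDiff_smoothCutoff _ _ _)
      ((tsupport_smoothCutoff_subset (by positivity) hpq).trans
        fun x hx => ⟨hap.trans_le hx.1, hx.2.trans_lt hqb⟩)
  filter_upwards [hslice, hcutoff] with y hslice_y hcutoff_y hy
  have huy : Continuous fun x => u (x, y) := by fun_prop
  have hvy : IntervalIntegrable (fun x => v (x, y)) volume a b :=
    (intervalIntegrable_iff_integrableOn_Ioo_of_le hab.le).2 (hslice_y hy)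
  refine ⟨hvy, sub_eq_integral_of_forall_rat hab huy.continuousOn hvy fun p q hap hpq hqb => ?_⟩
  refine sub_eq_integral_of_forall_smoothCutoff huy (hslice_y hy) hap hpq hqb fun n hn => ?_
  rw [← add_eq_zero_iff_eq_neg, ← integral_add]
  · exact hcutoff_y p q n hap hpq hn hy
  · have hderiv := (contDiff_smoothCutoff (n + 1) p q).continuous_deriv (by simp)
    exact ((huy.mul hderiv).integrableOn_Icc).mono_set Ioo_subset_Icc_self
  · exact (hslice_y hy).mul_bdd (contDiff_smoothCutoff _ _ _).continuous.aestronglyMeasurable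
      (.of_forall fun x => abs_smoothCutoff_le_one _ _ _ x)

end WeakDerivative

section AbsoluteContinuity

variable {a b c d : ℝ} {u v : ℝ × ℝ → ℝ} {ψ : ℝ → ℝ}

lemma absolutelyContinuousOnInterval_of_dist_le {X' Y' : Type*} [PseudoMetricSpace X']
    [PseudoMetricSpace Y'] {f : ℝ → X'} {g : ℝ → Y'} {K : ℝ}
    (hf : AbsolutelyContinuousOnInterval f a b)
    (h : ∀ x ∈ uIcc a b, ∀ y ∈ uIcc a b, dist (g x) (g y) ≤ K * dist (f x) (f y)) :
    AbsolutelyContinuousOnInterval g a b := by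
  have hlim := Tendsto.const_mul K hf
  rw [mul_zero] at hlim
  refine squeeze_zero' (.of_forall fun E => Finset.sum_nonneg fun _ _ => dist_nonneg) ?_ hlim
  filter_upwards [mem_inf_of_right (mem_principal_self _)] with E hE
  rw [Finset.mul_sum]
  exact Finset.sum_le_sum fun i hi => h _ (hE.1 i hi).1 _ (hE.1 i hi).2

lemma absolutelyContinuousOnInterval_comp_contDiff {f : ℝ → ℝ}
    (hf : AbsolutelyContinuousOnInterval f a b) (hψ : ContDiff ℝ 1 ψ) :
    AbsolutelyContinuousOnInterval (fun x => ψ (f x)) a b := by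
  obtain ⟨C, hC⟩ := hf.exists_bound
  obtain ⟨K, hK⟩ := hψ.contDiffOn.exists_lipschitzOnWith (s := Icc (-C) C) one_ne_zero
    (convex_Icc _ _) isCompact_Icc
  exact absolutelyContinuousOnInterval_of_dist_le hf fun x hx y hy =>
    hK.dist_le_mul _ (abs_le.1 (hC x hx)) _ (abs_le.1 (hC y hy))

lemma absolutelyContinuousOnInterval_of_sub_eq_integral {w f : ℝ → ℝ} (hab : a ≤ b)
    (hf : IntervalIntegrable f volume a b)
    (h : ∀ x ∈ Icc a b, w x - w a = ∫ t in a..x, f t) :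
    AbsolutelyContinuousOnInterval w a b := by
  refine absolutelyContinuousOnInterval_of_dist_le (K := 1)
    (hf.absolutelyContinuousOnInterval_intervalIntegral left_mem_uIcc) fun x hx y hy => ?_
  rw [uIcc_of_le hab] at hx hy
  rw [← h x hx, ← h y hy, dist_sub_right, one_mul]

lemma ae_deriv_eq_of_sub_eq_integral {w f : ℝ → ℝ} (hab : a ≤ b)
    (hf : IntervalIntegrable f volume a b)
    (h : ∀ x ∈ Icc a b, w x - w a = ∫ t in a..x, f t) :
    ∀ᵐ x, x ∈ Ioo a b → deriv w x = f x := by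
  filter_upwards [hf.ae_hasDerivAt_integral] with x hx hxab
  have hprim := hx (by rw [uIcc_of_le hab]; exact Ioo_subset_Icc_self hxab) a left_mem_uIcc
  refine ((hprim.add_const (w a)).congr_of_eventuallyEq ?_).deriv
  filter_upwards [isOpen_Ioo.mem_nhds hxab] with t ht
  exact sub_eq_iff_eq_add.1 (h t (Ioo_subset_Icc_self ht))

lemma comp_sub_eq_integral_deriv_mul {w : ℝ → ℝ} (hw : AbsolutelyContinuousOnInterval w a b)
    (hψ : ContDiff ℝ 1 ψ) : ψ (w b) - ψ (w a) = ∫ x in a..b, deriv ψ (w x) * deriv w x := by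
  rw [← (absolutelyContinuousOnInterval_comp_contDiff hw hψ).integral_deriv_eq_sub]
  apply intervalIntegral.integral_congr_ae
  filter_upwards [hw.ae_differentiableAt] with x hx hxab
  exact ((hψ.differentiable (by simp) (w x)).hasDerivAt.comp x
    (hx (uIoc_subset_uIcc hxab)).hasDerivAt).deriv

lemma ae_prod_of_ae_ae_swap {S T : Type*} [MeasurableSpace S] [MeasurableSpace T]
    {μ : Measure S} {ν : Measure T} [SFinite μ] [SFinite ν] {p : S × T → Prop}
    (hp : MeasurableSet {z | p z}) (h : ∀ᵐ y ∂ν, ∀ᵐ x ∂μ, p (x, y)) : ∀ᵐ z ∂μ.prod ν, p z := by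
  rw [Measure.ae_prod_iff_ae_ae hp]
  exact (Measure.ae_ae_comm (p := fun x y => p (x, y)) hp).2 h

lemma measurable_X (hu : Continuous u) : Measurable (X u) := by
  have hcurry : Continuous (Function.uncurry fun y t : ℝ => u (t, y)) := hu.comp continuous_swap
  exact (measurable_deriv_with_param hcurry).comp measurable_swap

lemma HasWeakDerivOn.X_ae_eq (hab : a < b) (hu : Continuous u)
    (h : HasWeakDerivOn (Ioo a b ×ˢ Ioo c d) (1, 0) u v)
    (hv : IntegrableOn v (Ioo a b ×ˢ Ioo c d)) :
    X u =ᵐ[volume.restrict (Ioo a b ×ˢ Ioo c d)] v := by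
  obtain ⟨v', hv'_meas, hvv'⟩ := hv.aestronglyMeasurable
  refine EventuallyEq.trans (g := v') ?_ hvv'.symm
  rw [volume_restrict_prod] at hvv' ⊢
  refine ae_prod_of_ae_ae_swap
    (measurableSet_eq_fun (measurable_X hu) hv'_meas.measurable) ?_
  filter_upwards [Measure.ae_ae_of_ae_prod
      (Measure.measurePreserving_swap.quasiMeasurePreserving.ae hvv'),
    ae_restrict_of_ae (h.ae_sub_eq_integral hab hu hv), ae_restrict_mem measurableSet_Ioo]
    with y hvv'_line hsub hy
  obtain ⟨hint, heq⟩ := hsub hy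
  filter_upwards [hvv'_line, ae_restrict_of_ae (ae_deriv_eq_of_sub_eq_integral hab.le hint heq),
    ae_restrict_mem measurableSet_Ioo] with x hx hderiv hxab
  exact (hderiv hxab).trans hx

/-- The pointwise partial derivative `∂u/∂y`. -/
noncomputable def partialY (u : ℝ × ℝ → ℝ) (z : ℝ × ℝ) : ℝ :=
  deriv (fun t => u (z.1, t)) z.2

lemma Y_eq_mul_partialY (α : ℝ) (u : ℝ × ℝ → ℝ) (z : ℝ × ℝ) :
    Y α u z = |z.1| ^ α * partialY u z := rfl

/-- `u` has an integrable weak derivative in the direction `e` on `U`. -/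
def HasIntegrableWeakDerivOn (U : Set (ℝ × ℝ)) (e : ℝ × ℝ) (u : ℝ × ℝ → ℝ) : Prop :=
  ∃ v, HasWeakDerivOn U e u v ∧ IntegrableOn v U

lemma HasIntegrableWeakDerivOn.integrableOn_X (hab : a < b) (hu : Continuous u)
    (h : HasIntegrableWeakDerivOn (Ioo a b ×ˢ Ioo c d) (1, 0) u) :
    IntegrableOn (X u) (Ioo a b ×ˢ Ioo c d) := by
  obtain ⟨v, hweak, hv⟩ := h
  exact hv.congr (hweak.X_ae_eq hab hu hv).symm

lemma HasIntegrableWeakDerivOn.ae_comp_sub_eq_integral_X (hab : a < b) (hu : Continuous u)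
    (h : HasIntegrableWeakDerivOn (Ioo a b ×ˢ Ioo c d) (1, 0) u) (hψ : ContDiff ℝ 1 ψ) :
    ∀ᵐ y, y ∈ Ioo c d → ∀ x₁ ∈ Icc a b, ∀ x₂ ∈ Icc a b,
      ψ (u (x₂, y)) - ψ (u (x₁, y)) = ∫ x in x₁..x₂, deriv ψ (u (x, y)) * X u (x, y) := by
  obtain ⟨v, hweak, hv⟩ := h
  filter_upwards [hweak.ae_sub_eq_integral hab hu hv] with y hline hy x₁ hx₁ x₂ hx₂
  obtain ⟨hint, heq⟩ := hline hy
  rw [← uIcc_of_le hab.le] at hx₁ hx₂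
  exact comp_sub_eq_integral_deriv_mul
    ((absolutelyContinuousOnInterval_of_sub_eq_integral hab.le hint heq).mono
      (uIcc_subset_uIcc hx₁ hx₂)) hψ

lemma measurePreserving_swap_real : MeasurePreserving (Prod.swap : ℝ × ℝ → ℝ × ℝ) :=
  Measure.measurePreserving_swap

lemma measurableEmbedding_swap_real : MeasurableEmbedding (Prod.swap : ℝ × ℝ → ℝ × ℝ) :=
  (Homeomorph.prodComm ℝ ℝ).measurableEmbedding

lemma integrableOn_comp_swap_iff {f : ℝ × ℝ → ℝ} {s : Set (ℝ × ℝ)} :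
    IntegrableOn (f ∘ Prod.swap) (Prod.swap ⁻¹' s) ↔ IntegrableOn f s :=
  measurePreserving_swap_real.integrableOn_comp_preimage measurableEmbedding_swap_real

lemma locallyIntegrableOn_comp_swap {f : ℝ × ℝ → ℝ} {s : Set (ℝ × ℝ)}
    (hf : LocallyIntegrableOn f s) : LocallyIntegrableOn (f ∘ Prod.swap) (Prod.swap ⁻¹' s) := by
  intro z hz
  obtain ⟨t, ht, hft⟩ := hf z.swap hz
  exact ⟨Prod.swap ⁻¹' t, continuous_swap.continuousWithinAt.tendsto_nhdsWithin
    (mapsTo_preimage Prod.swap s) ht, integrableOn_comp_swap_iff.2 hft⟩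

lemma fderiv_comp_swap_apply {φ : ℝ × ℝ → ℝ} (hφ : Differentiable ℝ φ) (z e : ℝ × ℝ) :
    fderiv ℝ (φ ∘ Prod.swap) z e = fderiv ℝ φ z.swap e.swap := by
  have hswap : HasFDerivAt (Prod.swap : ℝ × ℝ → ℝ × ℝ)
      (ContinuousLinearEquiv.prodComm ℝ ℝ ℝ : (ℝ × ℝ) →L[ℝ] ℝ × ℝ) z :=
    (ContinuousLinearEquiv.prodComm ℝ ℝ ℝ).hasFDerivAt
  rw [((hφ z.swap).hasFDerivAt.comp z hswap).fderiv]
  rfl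

lemma HasWeakDerivOn.comp_swap {U : Set (ℝ × ℝ)} {e : ℝ × ℝ} (h : HasWeakDerivOn U e u v) :
    HasWeakDerivOn (Prod.swap ⁻¹' U) e.swap (u ∘ Prod.swap) (v ∘ Prod.swap) := by
  refine ⟨locallyIntegrableOn_comp_swap h.1, locallyIntegrableOn_comp_swap h.2.1,
    fun φ hφ hφc hφU => ?_⟩
  have hsupport : tsupport (φ ∘ Prod.swap) ⊆ U := by
    rw [show tsupport (φ ∘ Prod.swap) = Prod.swap ⁻¹' tsupport φ from
      tsupport_comp_eq_preimage φ (Homeomorph.prodComm ℝ ℝ)]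
    exact fun z hz => hφU hz
  have hU := h.2.2 (φ ∘ Prod.swap) (hφ.comp (contDiff_snd.prodMk contDiff_fst))
    (hφc.comp_homeomorph (Homeomorph.prodComm ℝ ℝ)) hsupport
  have hswap (f : ℝ × ℝ → ℝ) :
      ∫ z in Prod.swap ⁻¹' U, f z.swap = ∫ z in U, f z :=
    measurePreserving_swap_real.setIntegral_preimage_emb measurableEmbedding_swap_real f U
  rw [← hswap, ← hswap] at hU
  simpa only [fderiv_comp_swap_apply (hφ.differentiable (by simp)), Function.comp_apply,
    Prod.swap_swap] using hU

lemma HasIntegrableWeakDerivOn.comp_swap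
    (h : HasIntegrableWeakDerivOn (Ioo a b ×ˢ Ioo c d) (0, 1) u) :
    HasIntegrableWeakDerivOn (Ioo c d ×ˢ Ioo a b) (1, 0) (u ∘ Prod.swap) := by
  obtain ⟨v, hweak, hv⟩ := h
  rw [← preimage_swap_prod]
  exact ⟨v ∘ Prod.swap, hweak.comp_swap, integrableOn_comp_swap_iff.2 hv⟩

lemma HasIntegrableWeakDerivOn.ae_comp_sub_eq_integral_partialY (hcd : c < d) (hu : Continuous u)
    (h : HasIntegrableWeakDerivOn (Ioo a b ×ˢ Ioo c d) (0, 1) u) (hψ : ContDiff ℝ 1 ψ) :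
    ∀ᵐ x, x ∈ Ioo a b → ∀ y₁ ∈ Icc c d, ∀ y₂ ∈ Icc c d,
      ψ (u (x, y₂)) - ψ (u (x, y₁)) = ∫ y in y₁..y₂, deriv ψ (u (x, y)) * partialY u (x, y) :=
  h.comp_swap.ae_comp_sub_eq_integral_X hcd (hu.comp continuous_swap) hψ

lemma countable_setOf_eq_deriv_ne_zero {E : Type*} [NormedAddCommGroup E] [NormedSpace ℝ E]
    (f : ℝ → E) (e : E) : {t | f t = e ∧ deriv f t ≠ 0}.Countable := by
  have hdiscrete : DiscreteTopology {t | f t = e ∧ deriv f t ≠ 0} := by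
    rw [discreteTopology_subtype_iff]
    intro t ht
    have hderiv := (differentiableAt_of_deriv_ne_zero ht.2).hasDerivAt
    rw [← disjoint_iff, disjoint_principal_right]
    filter_upwards [hderiv.eventually_ne ht.2] with s hs hsT
    exact hs hsT.1
  exact countable_coe_iff.1 (TopologicalSpace.separableSpace_iff_countable.1 inferInstance)

lemma ae_X_eq_zero_of_eq_zero (hu : Continuous u) : ∀ᵐ z, u z = 0 → X u z = 0 := by
  have hmeas : MeasurableSet {z | u z = 0 → X u z = 0} :=
    (measurableSet_eq_fun hu.measurable measurable_const).imp
      (measurableSet_eq_fun (measurable_X hu) measurable_const)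
  refine ae_prod_of_ae_ae_swap hmeas (.of_forall fun y => ?_)
  filter_upwards [(countable_setOf_eq_deriv_ne_zero (fun t => u (t, y)) 0).ae_notMem volume]
    with x hx hux
  exact not_not.1 fun hX => hx ⟨hux, hX⟩

lemma ae_partialY_eq_zero_of_eq_zero (hu : Continuous u) : ∀ᵐ z, u z = 0 → partialY u z = 0 :=
  measurePreserving_swap_real.quasiMeasurePreserving.ae
    (ae_X_eq_zero_of_eq_zero (hu.comp continuous_swap))

end AbsoluteContinuity

section Coordinates

variable {α : ℝ}

/-- The primitive `x |x|^α / (α + 1)` of `|x|^α`, the change of variable in the first coordinate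
which makes the Grushin plane conformal to `ℂ`. -/
noncomputable def powPrimitive (α x : ℝ) : ℝ := x * |x| ^ α / (α + 1)

@[simp] lemma powPrimitive_zero (α : ℝ) : powPrimitive α 0 = 0 := by simp [powPrimitive]

lemma powPrimitive_neg (α x : ℝ) : powPrimitive α (-x) = -powPrimitive α x := by
  rw [powPrimitive, powPrimitive, abs_neg, neg_mul, neg_div]

lemma powPrimitive_mul {r : ℝ} (hr : 0 < r) (α x : ℝ) :
    powPrimitive α (r * x) = r ^ (α + 1) * powPrimitive α x := by
  rw [powPrimitive, powPrimitive, abs_mul, abs_of_pos hr, Real.mul_rpow hr.le (abs_nonneg x),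
    Real.rpow_add_one hr.ne']
  ring

lemma powPrimitive_of_nonneg (hα : 0 ≤ α) {x : ℝ} (hx : 0 ≤ x) :
    powPrimitive α x = x ^ (α + 1) / (α + 1) := by
  rw [powPrimitive, abs_of_nonneg hx, Real.rpow_add_one' hx (by positivity), mul_comm]

lemma abs_powPrimitive (hα : 0 ≤ α) (x : ℝ) :
    |powPrimitive α x| = |x| ^ (α + 1) / (α + 1) := by
  have hα1 : 0 < α + 1 := by positivity
  rw [powPrimitive, abs_div, abs_mul, abs_of_pos hα1,
    abs_of_nonneg (Real.rpow_nonneg (abs_nonneg x) α),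
    Real.rpow_add_one' (abs_nonneg x) hα1.ne', mul_comm]

lemma continuous_abs_rpow (hα : 0 ≤ α) : Continuous fun x : ℝ => |x| ^ α :=
  continuous_abs.rpow_const fun _ => Or.inr hα

lemma continuous_powPrimitive (hα : 0 ≤ α) : Continuous (powPrimitive α) :=
  (continuous_id.mul (continuous_abs_rpow hα)).div_const _

lemma hasDerivAt_powPrimitive_of_ne_zero (hα : 0 ≤ α) {x : ℝ} (hx : x ≠ 0) :
    HasDerivAt (powPrimitive α) (|x| ^ α) x := by
  have habs : |x| ≠ 0 := abs_ne_zero.2 hx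
  have hprod := ((hasDerivAt_id x).mul
    ((hasDerivAt_abs hx).rpow_const (p := α) (Or.inl habs))).div_const (α + 1)
  refine hprod.congr_deriv ?_
  have hα1 : α + 1 ≠ 0 := by positivity
  calc (1 * |x| ^ α + x * (SignType.sign x * α * |x| ^ (α - 1))) / (α + 1)
      = (|x| ^ α + x * SignType.sign x * α * |x| ^ (α - 1)) / (α + 1) := by ring
    _ = |x| ^ α := by
      rw [self_mul_sign, Real.rpow_sub_one habs]
      field_simp
      ring

lemma hasDerivAt_powPrimitive (hα : 0 ≤ α) (x : ℝ) :
    HasDerivAt (powPrimitive α) (|x| ^ α) x := by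
  rcases eq_or_ne x 0 with rfl | hx
  · exact hasDerivAt_of_hasDerivAt_of_ne (g := fun x : ℝ => |x| ^ α)
      (fun y hy => hasDerivAt_powPrimitive_of_ne_zero hα hy)
      (continuous_powPrimitive hα).continuousAt (continuous_abs_rpow hα).continuousAt
  · exact hasDerivAt_powPrimitive_of_ne_zero hα hx

lemma deriv_powPrimitive (hα : 0 ≤ α) : deriv (powPrimitive α) = fun x => |x| ^ α :=
  funext fun x => (hasDerivAt_powPrimitive hα x).deriv

lemma contDiff_powPrimitive (hα : 0 ≤ α) : ContDiff ℝ 1 (powPrimitive α) := by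
  rw [contDiff_one_iff_deriv, deriv_powPrimitive hα]
  exact ⟨fun x => (hasDerivAt_powPrimitive hα x).differentiableAt, continuous_abs_rpow hα⟩

lemma strictMono_powPrimitive (hα : 0 ≤ α) : StrictMono (powPrimitive α) := by
  refine strictMono_of_odd_strictMonoOn_nonneg (powPrimitive_neg α) fun x hx y hy hxy => ?_
  rw [powPrimitive_of_nonneg hα hx, powPrimitive_of_nonneg hα hy]
  have hpow := Real.rpow_lt_rpow hx hxy (by positivity : 0 < α + 1)
  gcongr

lemma surjective_powPrimitive (hα : 0 ≤ α) : Function.Surjective (powPrimitive α) := by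
  have hα1 : 0 < α + 1 := by positivity
  have hnonneg (u : ℝ) (hu : 0 ≤ u) : ∃ x, powPrimitive α x = u := by
    refine ⟨((α + 1) * u) ^ (α + 1)⁻¹, ?_⟩
    rw [powPrimitive_of_nonneg hα (by positivity), Real.rpow_inv_rpow (by positivity) hα1.ne',
      mul_div_cancel_left₀ _ hα1.ne']
  intro u
  rcases le_total 0 u with hu | hu
  · exact hnonneg u hu
  · obtain ⟨x, hx⟩ := hnonneg (-u) (neg_nonneg.2 hu)
    exact ⟨-x, by rw [powPrimitive_neg, hx, neg_neg]⟩

lemma powPrimitive_eq_zero (hα : 0 ≤ α) {x : ℝ} : powPrimitive α x = 0 ↔ x = 0 :=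
  (strictMono_powPrimitive hα).injective.eq_iff' (powPrimitive_zero α)

/-- The homeomorphism of `ℝ × ℝ` onto `ℂ` sending `(x, y)` to `powPrimitive α x + i y`. -/
noncomputable def toComplex (hα : 0 ≤ α) : (ℝ × ℝ) ≃ₜ ℂ :=
  ((((strictMono_powPrimitive hα).orderIsoOfSurjective _
    (surjective_powPrimitive hα)).toHomeomorph).prodCongr (Homeomorph.refl ℝ)).trans
    Complex.equivRealProdCLM.symm.toHomeomorph

lemma toComplex_apply (hα : 0 ≤ α) (z : ℝ × ℝ) : toComplex hα z = ⟨powPrimitive α z.1, z.2⟩ := by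
  apply Complex.ext <;> simp [toComplex]

@[simp] lemma toComplex_re (hα : 0 ≤ α) (z : ℝ × ℝ) :
    (toComplex hα z).re = powPrimitive α z.1 := by
  rw [toComplex_apply]

@[simp] lemma toComplex_im (hα : 0 ≤ α) (z : ℝ × ℝ) : (toComplex hα z).im = z.2 := by
  rw [toComplex_apply]

lemma toComplex_eq (hα : 0 ≤ α) (x y : ℝ) :
    toComplex hα (x, y) = powPrimitive α x + y * Complex.I := by
  apply Complex.ext <;> simp

/-- The map `g` read in the coordinates `toComplex` of the source and of the target. -/
noncomputable def conjMap (hα : 0 ≤ α) (g : OpenPartialHomeomorph (ℝ × ℝ) (ℝ × ℝ)) :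
    OpenPartialHomeomorph ℂ ℂ :=
  ((toComplex hα).symm.transOpenPartialHomeomorph g).transHomeomorph (toComplex hα)

variable (hα : 0 ≤ α) (g h : OpenPartialHomeomorph (ℝ × ℝ) (ℝ × ℝ))

lemma conjMap_toComplex (z : ℝ × ℝ) : conjMap hα g (toComplex hα z) = toComplex hα (g z) :=
  congrArg (fun w => toComplex hα (g w)) ((toComplex hα).symm_apply_apply z)

lemma conjMap_source : (conjMap hα g).source = (toComplex hα).symm ⁻¹' g.source := rfl

lemma toComplex_mem_conjMap_source {z : ℝ × ℝ} :
    toComplex hα z ∈ (conjMap hα g).source ↔ z ∈ g.source := by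
  rw [conjMap_source, mem_preimage, Homeomorph.symm_apply_apply]

lemma conjMap_symm : conjMap hα g.symm = (conjMap hα g).symm := rfl

lemma conjMap_trans : conjMap hα (h.trans g) = (conjMap hα h).trans (conjMap hα g) := by
  refine OpenPartialHomeomorph.ext _ _ (fun w => ?_) (fun w => ?_) ?_
  · simp [conjMap]
  · simp [conjMap]
  · ext w
    simp [conjMap]

end Coordinates

section CauchyRiemann

variable {α a b c d a' b' c' d' : ℝ}

lemma integral_sub_eq_integral_sub_of_ae_line_integral {P Q k k' : ℝ × ℝ → ℝ}
    (hk : IntegrableOn k (Ioo a b ×ˢ Ioo c d))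
    (hkk' : k =ᵐ[volume.restrict (Ioo a b ×ˢ Ioo c d)] k')
    (hP : ∀ᵐ y, y ∈ Ioo c d → ∀ x₁ ∈ Icc a b, ∀ x₂ ∈ Icc a b,
      P (x₂, y) - P (x₁, y) = ∫ x in x₁..x₂, k (x, y))
    (hQ : ∀ᵐ x, x ∈ Ioo a b → ∀ y₁ ∈ Icc c d, ∀ y₂ ∈ Icc c d,
      Q (x, y₂) - Q (x, y₁) = ∫ y in y₁..y₂, k' (x, y))
    (ha' : a' ∈ Ioo a b) (hb' : b' ∈ Ioo a b) (hc' : c' ∈ Ioo c d) (hd' : d' ∈ Ioo c d) :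
    ∫ y in c'..d', (P (b', y) - P (a', y)) = ∫ x in a'..b', (Q (x, d') - Q (x, c')) := by
  have hI : uIoc a' b' ⊆ Ioo a b := uIoc_subset_uIcc.trans (ordConnected_Ioo.uIcc_subset ha' hb')
  have hJ : uIoc c' d' ⊆ Ioo c d := uIoc_subset_uIcc.trans (ordConnected_Ioo.uIcc_subset hc' hd')
  have hkk'_line : ∀ᵐ x, x ∈ Ioo a b → ∀ᵐ y, y ∈ Ioo c d → k (x, y) = k' (x, y) := by
    rw [EventuallyEq, volume_restrict_prod] at hkk'
    simpa only [ae_restrict_iff' measurableSet_Ioo] using Measure.ae_ae_of_ae_prod hkk'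
  calc ∫ y in c'..d', (P (b', y) - P (a', y))
      = ∫ y in c'..d', ∫ x in a'..b', k (x, y) := by
        apply intervalIntegral.integral_congr_ae
        filter_upwards [hP] with y hy hyJ
        exact hy (hJ hyJ) _ (Ioo_subset_Icc_self ha') _ (Ioo_subset_Icc_self hb')
    _ = ∫ x in a'..b', ∫ y in c'..d', k (x, y) :=
        (intervalIntegral_intervalIntegral_swap (F := fun x y => k (x, y))
          (hk.mono_set (prod_mono hI hJ))).symm
    _ = ∫ x in a'..b', (Q (x, d') - Q (x, c')) := by
        apply intervalIntegral.integral_congr_ae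
        filter_upwards [hQ, hkk'_line] with x hx hkk'x hxI
        rw [hx (hI hxI) _ (Ioo_subset_Icc_self hc') _ (Ioo_subset_Icc_self hd')]
        apply intervalIntegral.integral_congr_ae
        filter_upwards [hkk'x (hI hxI)] with y hy hyJ using hy (hJ hyJ)

lemma HasIntegrableWeakDerivOn.integral_comp_sub_eq {u v : ℝ × ℝ → ℝ} {ψ χ : ℝ → ℝ} {w : ℝ → ℝ}
    (hu : Continuous u) (hux : HasIntegrableWeakDerivOn (Ioo a b ×ˢ Ioo c d) (1, 0) u)
    (hv : Continuous v) (hvy : HasIntegrableWeakDerivOn (Ioo a b ×ˢ Ioo c d) (0, 1) v)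
    (hψ : ContDiff ℝ 1 ψ) (hχ : ContDiff ℝ 1 χ) (hw : Continuous w)
    (heq : ∀ᵐ z ∂volume.restrict (Ioo a b ×ˢ Ioo c d),
      deriv ψ (u z) * X u z = w z.1 * (deriv χ (v z) * partialY v z))
    (ha' : a' ∈ Ioo a b) (hb' : b' ∈ Ioo a b) (hc' : c' ∈ Ioo c d) (hd' : d' ∈ Ioo c d) :
    (∫ y in c'..d', ψ (u (b', y))) - ∫ y in c'..d', ψ (u (a', y)) =
      (∫ x in a'..b', w x * χ (v (x, d'))) - ∫ x in a'..b', w x * χ (v (x, c')) := by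
  have hab : a < b := ha'.1.trans ha'.2
  have hcd : c < d := hc'.1.trans hc'.2
  have hint : IntegrableOn (fun z => deriv ψ (u z) * X u z) (Ioo a b ×ˢ Ioo c d) :=
    (hux.integrableOn_X hab hu).continuousOn_mul_of_subset
      ((hψ.continuous_deriv le_rfl).comp hu).continuousOn (isCompact_Icc.prod isCompact_Icc)
      (measurableSet_Ioo.prod measurableSet_Ioo)
      (prod_mono Ioo_subset_Icc_self Ioo_subset_Icc_self)
  have hψ_cont := hψ.continuous
  have hχ_cont := hχ.continuous
  have hsub {p q : ℝ → ℝ} (hp : Continuous p) (hq : Continuous q) (s t : ℝ) :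
      (∫ x in s..t, p x) - ∫ x in s..t, q x = ∫ x in s..t, (p x - q x) :=
    (intervalIntegral.integral_sub (hp.intervalIntegrable _ _) (hq.intervalIntegrable _ _)).symm
  rw [hsub (by fun_prop) (by fun_prop), hsub (by fun_prop) (by fun_prop)]
  refine integral_sub_eq_integral_sub_of_ae_line_integral (P := fun z => ψ (u z))
    (Q := fun z => w z.1 * χ (v z)) hint heq (hux.ae_comp_sub_eq_integral_X hab hu hψ) ?_
    ha' hb' hc' hd'
  filter_upwards [hvy.ae_comp_sub_eq_integral_partialY hcd hv hχ] with x hx hxI y₁ hy₁ y₂ hy₂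
  rw [intervalIntegral.integral_const_mul, ← hx hxI y₁ hy₁ y₂ hy₂, mul_sub]

/-- The Cauchy–Riemann equations at `z` of the map `f` of the Grushin plane: those of
`toComplex ∘ f ∘ toComplex⁻¹`, cleared of denominators. -/
def CauchyRiemannAt (α : ℝ) (f : ℝ × ℝ → ℝ × ℝ) (z : ℝ × ℝ) : Prop :=
  |(f z).1| ^ α * X (fun w => (f w).1) z = Y α (fun w => (f w).2) z ∧
    |(f z).1| ^ α * Y α (fun w => (f w).1) z = -X (fun w => (f w).2) z

variable {u : ℝ × ℝ → ℝ × ℝ}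

lemma intervalIntegral_eq_re_add_im {f : ℝ → ℂ} (hf : Continuous f) :
    ∫ t in a..b, f t = (∫ t in a..b, (f t).re : ℝ) + (∫ t in a..b, (f t).im : ℝ) * Complex.I := by
  rw [← Complex.re_add_im (∫ t in a..b, f t)]
  congr 3
  · exact (Complex.reCLM.intervalIntegral_comp_comm (hf.intervalIntegrable a b)).symm
  · exact (Complex.imCLM.intervalIntegral_comp_comm (hf.intervalIntegrable a b)).symm

lemma integral_toComplex_comp_horizontal (hα : 0 ≤ α) (hu : Continuous u) (y : ℝ) :
    ∫ s in powPrimitive α a..powPrimitive α b,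
        toComplex hα (u ((toComplex hα).symm (s + y * Complex.I))) =
      (∫ x in a..b, |x| ^ α * powPrimitive α (u (x, y)).1 : ℝ) +
        (∫ x in a..b, |x| ^ α * (u (x, y)).2 : ℝ) * Complex.I := by
  have hα_cont := continuous_abs_rpow hα
  have hto := (toComplex hα).continuous
  have hto_symm := (toComplex hα).symm.continuous
  rw [← intervalIntegral.integral_deriv_smul_comp (f' := fun x => |x| ^ α)
    (g := fun s : ℝ => toComplex hα (u ((toComplex hα).symm (s + y * Complex.I))))
    (fun x _ => hasDerivAt_powPrimitive hα x) hα_cont.continuousOn (by fun_prop)]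
  simp only [Function.comp_apply, ← toComplex_eq hα, Homeomorph.symm_apply_apply]
  rw [intervalIntegral_eq_re_add_im (by fun_prop)]
  simp only [Complex.smul_re, Complex.smul_im, toComplex_re, toComplex_im, smul_eq_mul]

lemma integral_toComplex_comp_vertical (hα : 0 ≤ α) (hu : Continuous u) (x : ℝ) :
    ∫ y in c..d, toComplex hα (u ((toComplex hα).symm (powPrimitive α x + y * Complex.I))) =
      (∫ y in c..d, powPrimitive α (u (x, y)).1 : ℝ) +
        (∫ y in c..d, (u (x, y)).2 : ℝ) * Complex.I := by
  have hto := (toComplex hα).continuous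
  simp only [← toComplex_eq hα, Homeomorph.symm_apply_apply]
  rw [intervalIntegral_eq_re_add_im (by fun_prop)]
  simp only [toComplex_re, toComplex_im]

/-- Morera's theorem: by the two Green identities coming from the Cauchy–Riemann equations, the
integral over the boundary of every rectangle vanishes. -/
theorem differentiableOn_toComplex_comp_of_cauchyRiemann (hα : 0 ≤ α) (hu : Continuous u)
    (hux₁ : HasIntegrableWeakDerivOn (Ioo a b ×ˢ Ioo c d) (1, 0) fun z => (u z).1)
    (huy₁ : HasIntegrableWeakDerivOn (Ioo a b ×ˢ Ioo c d) (0, 1) fun z => (u z).1)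
    (hux₂ : HasIntegrableWeakDerivOn (Ioo a b ×ˢ Ioo c d) (1, 0) fun z => (u z).2)
    (huy₂ : HasIntegrableWeakDerivOn (Ioo a b ×ˢ Ioo c d) (0, 1) fun z => (u z).2)
    (hCR : ∀ᵐ z ∂volume.restrict (Ioo a b ×ˢ Ioo c d), CauchyRiemannAt α u z) :
    DifferentiableOn ℂ (fun w => toComplex hα (u ((toComplex hα).symm w)))
      (toComplex hα '' (Ioo a b ×ˢ Ioo c d)) := by
  have hopen : IsOpen (toComplex hα '' (Ioo a b ×ˢ Ioo c d)) :=
    (toComplex hα).isOpenMap _ (isOpen_Ioo.prod isOpen_Ioo)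
  have hα_cont := continuous_abs_rpow hα
  rw [← Complex.isConservativeOn_and_continuousOn_iff_isDifferentiableOn hopen]
  refine ⟨fun z w hzw => ?_, ((toComplex hα).continuous.comp
    (hu.comp (toComplex hα).symm.continuous)).continuousOn⟩
  obtain ⟨⟨a', c'⟩, ⟨ha', hc'⟩, rfl⟩ := hzw (show z ∈ _ by
    simp [Complex.Rectangle, Complex.mem_reProdIm])
  obtain ⟨⟨b', d'⟩, ⟨hb', hd'⟩, rfl⟩ := hzw (show w ∈ _ by
    simp [Complex.Rectangle, Complex.mem_reProdIm])
  dsimp only at ha' hb' hc' hd'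
  have hgreen_im :=
    hux₁.integral_comp_sub_eq (χ := id) (by fun_prop) (by fun_prop) huy₂
      (contDiff_powPrimitive hα) contDiff_id hα_cont (by
        filter_upwards [hCR] with z hz
        simpa [deriv_powPrimitive hα, Y_eq_mul_partialY] using hz.1) ha' hb' hc' hd'
  have hgreen_re :=
    hux₂.integral_comp_sub_eq (ψ := id) (by fun_prop) (by fun_prop) huy₁
      contDiff_id (contDiff_powPrimitive hα) hα_cont.neg (by
        filter_upwards [hCR] with z hz
        simpa [deriv_powPrimitive hα, Y_eq_mul_partialY, mul_left_comm, neg_eq_iff_eq_neg]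
          using (neg_eq_iff_eq_neg.2 hz.2).symm) ha' hb' hc' hd'
  simp only [id_eq, Pi.neg_apply, neg_mul, intervalIntegral.integral_neg] at hgreen_im hgreen_re
  rw [← add_eq_zero_iff_eq_neg, Complex.wedgeIntegral_add_wedgeIntegral_eq]
  simp only [toComplex_re, toComplex_im, integral_toComplex_comp_horizontal hα hu,
    integral_toComplex_comp_vertical hα hu, smul_eq_mul]
  have hgreen_re_ofReal := congrArg Complex.ofReal hgreen_re
  have hgreen_im_ofReal := congrArg Complex.ofReal hgreen_im
  simp only [Complex.ofReal_sub, Complex.ofReal_neg] at hgreen_re_ofReal hgreen_im_ofReal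
  linear_combination Complex.I * hgreen_im_ofReal - hgreen_re_ofReal +
    (((∫ y in c'..d', (u (b', y)).2 : ℝ) : ℂ) - (∫ y in c'..d', (u (a', y)).2 : ℝ)) *
      Complex.I_sq

end CauchyRiemann

section Holomorphy

variable {α a b c d : ℝ} {f f' u : ℝ × ℝ → ℝ × ℝ} {z : ℝ × ℝ} {Ω : Set (ℝ × ℝ)}
  {g : OpenPartialHomeomorph (ℝ × ℝ) (ℝ × ℝ)}

lemma X_congr {v v' : ℝ × ℝ → ℝ} (h : v =ᶠ[𝓝 z] v') : X v z = X v' z := by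
  have hline : Tendsto (fun t : ℝ => (t, z.2)) (𝓝 z.1) (𝓝 z) :=
    Continuous.tendsto' (by fun_prop) z.1 z rfl
  exact (h.comp_tendsto hline).deriv_eq

lemma partialY_congr {v v' : ℝ × ℝ → ℝ} (h : v =ᶠ[𝓝 z] v') : partialY v z = partialY v' z := by
  have hline : Tendsto (fun t : ℝ => (z.1, t)) (𝓝 z.2) (𝓝 z) :=
    Continuous.tendsto' (by fun_prop) z.2 z rfl
  exact (h.comp_tendsto hline).deriv_eq

lemma DH_congr (h : f =ᶠ[𝓝 z] f') : DH α f z = DH α f' z := by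
  have h₁ : (fun w => (f w).1) =ᶠ[𝓝 z] fun w => (f' w).1 := h.fun_comp Prod.fst
  have h₂ : (fun w => (f w).2) =ᶠ[𝓝 z] fun w => (f' w).2 := h.fun_comp Prod.snd
  simp only [DH, Y_eq_mul_partialY, X_congr h₁, X_congr h₂, partialY_congr h₁, partialY_congr h₂]

lemma det_DH (α : ℝ) (f : ℝ × ℝ → ℝ × ℝ) (z : ℝ × ℝ) : (DH α f z).det =
    X (fun w => (f w).1) z * Y α (fun w => (f w).2) z -
      Y α (fun w => (f w).1) z * X (fun w => (f w).2) z :=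
  Matrix.det_fin_two_of ..

lemma Dα_eq_DH_div (α : ℝ) (f : ℝ × ℝ → ℝ × ℝ) (z : ℝ × ℝ) :
    Dα α f z = !![DH α f z 0 0, DH α f z 0 1;
      DH α f z 1 0 / |(f z).1| ^ α, DH α f z 1 1 / |(f z).1| ^ α] := rfl

lemma Dα_congr (h : f =ᶠ[𝓝 z] f') : Dα α f z = Dα α f' z := by
  rw [Dα_eq_DH_div, Dα_eq_DH_div, DH_congr h, h.eq_of_nhds]

lemma det_Dα (α : ℝ) (f : ℝ × ℝ → ℝ × ℝ) (z : ℝ × ℝ) :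
    (Dα α f z).det = (DH α f z).det / |(f z).1| ^ α := by
  rw [Dα_eq_DH_div, Matrix.det_fin_two_of, Matrix.det_fin_two]
  ring

lemma mem_regularSet : z ∈ regularSet Ω f ↔ z ∈ Ω ∧ z.1 ≠ 0 ∧ (f z).1 ≠ 0 := by
  simp only [regularSet, singularSet, Set.mem_sdiff, mem_ofPred_eq, not_and, not_or]
  exact and_congr_right fun hz => forall_prop_of_true hz

lemma isOpen_regularSet (g : OpenPartialHomeomorph (ℝ × ℝ) (ℝ × ℝ)) :
    IsOpen (regularSet g.source g) := by
  have hopen : IsOpen {z : ℝ × ℝ | z.1 ≠ 0} := isOpen_ne.preimage continuous_fst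
  convert (g.isOpen_inter_preimage hopen).inter hopen using 1
  ext z
  rw [mem_regularSet, mem_inter_iff, mem_inter_iff, and_assoc, and_comm (a := z.1 ≠ 0)]
  rfl

lemma ae_fst_ne_zero : ∀ᵐ z : ℝ × ℝ, z.1 ≠ 0 :=
  Measure.quasiMeasurePreserving_fst.ae (Measure.ae_ne volume 0)

lemma ae_fst_ne_zero_of_det_DH_pos (hu : Continuous u) :
    ∀ᵐ z, 0 < (DH α u z).det → (u z).1 ≠ 0 := by
  filter_upwards [ae_X_eq_zero_of_eq_zero (continuous_fst.comp hu),
    ae_partialY_eq_zero_of_eq_zero (continuous_fst.comp hu)] with z hX hY hdet hzero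
  have hX' : X (fun w => (u w).1) z = 0 := hX hzero
  have hY' : partialY (fun w => (u w).1) z = 0 := hY hzero
  simp [det_DH, Y_eq_mul_partialY, hX', hY'] at hdet

lemma cauchyRiemannAt_of_Dα_eq_smul (hf : (f z).1 ≠ 0) (hdet : 0 < (DH α f z).det) {r : ℝ}
    {O : Matrix (Fin 2) (Fin 2) ℝ} (hO : O ∈ Matrix.orthogonalGroup (Fin 2) ℝ)
    (h : Dα α f z = r • O) : CauchyRiemannAt α f z := by
  have hpos : 0 < |(f z).1| ^ α := Real.rpow_pos_of_pos (abs_pos.2 hf) _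
  have hdetO : O.det = 1 := by
    have hsq : O.det * O.det = 1 := (Matrix.det_of_mem_unitary hO).1
    have hscale : 0 < r ^ 2 * O.det := by
      have hdetD := div_pos hdet hpos
      rwa [← det_Dα, h, Matrix.det_smul, Fintype.card_fin] at hdetD
    exact (mul_self_eq_one_iff.1 hsq).resolve_right fun hneg => by
      rw [hneg] at hscale
      nlinarith [sq_nonneg r]
  obtain ⟨hdiag, hanti, -⟩ := Matrix.mem_specialOrthogonalGroup_fin_two_iff.1
    (Matrix.mem_specialOrthogonalGroup_iff.2 ⟨hO, hdetO⟩)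
  have hentry (i j : Fin 2) : Dα α f z i j = r * O i j := congrFun (congrFun h i) j
  have hdiag' : Dα α f z 0 0 = Dα α f z 1 1 := by rw [hentry, hentry, hdiag]
  have hanti' : Dα α f z 0 1 = -Dα α f z 1 0 := by rw [hentry, hentry, hanti, mul_neg]
  simp only [Dα, Matrix.of_apply, Matrix.cons_val', Matrix.cons_val_zero, Matrix.cons_val_one,
    Matrix.cons_val_fin_one] at hdiag' hanti'
  exact ⟨by rw [hdiag', mul_div_cancel₀ _ hpos.ne'],
    by rw [hanti', mul_neg, mul_div_cancel₀ _ hpos.ne']⟩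

lemma IsConformal.ae_cauchyRiemannAt (hg : IsConformal α g)
    (hor : OrientationPreserving α g.source g.target g) {U : Set (ℝ × ℝ)} (hU : IsOpen U)
    (hUs : U ⊆ g.source) (hu : Continuous u) (hgu : EqOn g u U) :
    ∀ᵐ z ∂volume.restrict U, CauchyRiemannAt α u z := by
  have hdet := hor.2
  have hsim := hg.2.1
  rw [ae_restrict_iff' g.open_source.measurableSet] at hdet
  rw [ae_restrict_iff' (isOpen_regularSet g).measurableSet] at hsim
  rw [ae_restrict_iff' hU.measurableSet]
  filter_upwards [hdet, hsim, ae_fst_ne_zero, ae_fst_ne_zero_of_det_DH_pos hu]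
    with z hdet hsim hz hne hzU
  have hgu_nhds : g =ᶠ[𝓝 z] u := hgu.eventuallyEq_of_mem (hU.mem_nhds hzU)
  rw [DH_congr hgu_nhds] at hdet
  rw [Dα_congr hgu_nhds] at hsim
  have hdet_pos := hdet (hUs hzU)
  have hu_ne := hne hdet_pos
  obtain ⟨r, -, O, hO, hDα⟩ := hsim (mem_regularSet.2 ⟨hUs hzU, hz, by rwa [hgu hzU]⟩)
  exact cauchyRiemannAt_of_Dα_eq_smul hu_ne hdet_pos hO hDα

lemma exists_continuous_eqOn.{u, v} {S : Type u} {T : Type v} [TopologicalSpace S] [NormalSpace S]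
    [TopologicalSpace T] [TietzeExtension.{u, v} T] {s : Set S} (hs : IsClosed s) {f : S → T}
    (hf : ContinuousOn f s) : ∃ f' : S → T, Continuous f' ∧ EqOn f f' s := by
  obtain ⟨f', hf'⟩ := ContinuousMap.exists_restrict_eq hs ⟨s.domRestrict f, hf.domRestrict⟩
  exact ⟨f', f'.continuous, fun z hz => (DFunLike.congr_fun hf' ⟨z, hz⟩).symm⟩

lemma HasWeakDerivOn.hasIntegrableWeakDerivOn {V : Set (ℝ × ℝ)} {e : ℝ × ℝ} {v v' w : ℝ × ℝ → ℝ}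
    (h : HasWeakDerivOn V e v w) (hV : Icc a b ×ˢ Icc c d ⊆ V)
    (hvv' : EqOn v v' (Icc a b ×ˢ Icc c d)) :
    HasIntegrableWeakDerivOn (Ioo a b ×ˢ Ioo c d) e v' := by
  have hsub : Ioo a b ×ˢ Ioo c d ⊆ Icc a b ×ˢ Icc c d :=
    prod_mono Ioo_subset_Icc_self Ioo_subset_Icc_self
  exact ⟨w, (h.mono (hsub.trans hV)).congr (measurableSet_Ioo.prod measurableSet_Ioo)
    (hvv'.mono hsub), (h.2.1.integrableOn_compact_subset hV
      (isCompact_Icc.prod isCompact_Icc)).mono_set hsub⟩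

lemma IsConformal.differentiableOn_toComplex_comp (hg : IsConformal α g)
    (hor : OrientationPreserving α g.source g.target g) (hα : 0 ≤ α)
    (hs : Icc a b ×ˢ Icc c d ⊆ g.source) (hu : Continuous u)
    (hgu : EqOn g u (Icc a b ×ˢ Icc c d)) :
    DifferentiableOn ℂ (fun w => toComplex hα (u ((toComplex hα).symm w)))
      (toComplex hα '' (Ioo a b ×ˢ Ioo c d)) := by
  have hsub : Ioo a b ×ˢ Ioo c d ⊆ Icc a b ×ˢ Icc c d :=
    prod_mono Ioo_subset_Icc_self Ioo_subset_Icc_self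
  obtain ⟨V, hV, hQV, hVs, hV_compact⟩ := exists_open_between_and_isCompact_closure
    (isCompact_Icc.prod isCompact_Icc) g.open_source hs
  obtain ⟨-, ⟨-, _, _, hx₁, hy₁, -, -⟩, ⟨-, _, _, hx₂, hy₂, -, -⟩⟩ := hor.1.2 V hV hV_compact hVs
  have hgu₁ : EqOn (fun z => (g z).1) (fun z => (u z).1) (Icc a b ×ˢ Icc c d) :=
    fun z hz => congrArg Prod.fst (hgu hz)
  have hgu₂ : EqOn (fun z => (g z).2) (fun z => (u z).2) (Icc a b ×ˢ Icc c d) :=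
    fun z hz => congrArg Prod.snd (hgu hz)
  exact differentiableOn_toComplex_comp_of_cauchyRiemann hα hu
    (hx₁.hasIntegrableWeakDerivOn hQV hgu₁) (hy₁.hasIntegrableWeakDerivOn hQV hgu₁)
    (hx₂.hasIntegrableWeakDerivOn hQV hgu₂) (hy₂.hasIntegrableWeakDerivOn hQV hgu₂)
    (hg.ae_cauchyRiemannAt hor (isOpen_Ioo.prod isOpen_Ioo) (hsub.trans hs) hu (hgu.mono hsub))

theorem IsConformal.differentiableOn_conjMap (hg : IsConformal α g)
    (hor : OrientationPreserving α g.source g.target g) (hα : 0 ≤ α) :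
    DifferentiableOn ℂ (conjMap hα g) (conjMap hα g).source := by
  intro w₀ hw₀
  obtain ⟨z₀, rfl⟩ := (toComplex hα).surjective w₀
  rw [toComplex_mem_conjMap_source] at hw₀
  obtain ⟨r, hr, hball⟩ := Metric.nhds_basis_closedBall.mem_iff.1 (g.open_source.mem_nhds hw₀)
  rw [← Prod.mk.eta (p := z₀), ← closedBall_prod_same, Real.closedBall_eq_Icc,
    Real.closedBall_eq_Icc] at hball
  obtain ⟨u, hu, hgu⟩ := exists_continuous_eqOn (isClosed_Icc.prod isClosed_Icc)
    (g.continuousOn.mono hball)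
  have hnhds : toComplex hα '' (Ioo (z₀.1 - r) (z₀.1 + r) ×ˢ Ioo (z₀.2 - r) (z₀.2 + r)) ∈
      𝓝 (toComplex hα z₀) := by
    refine (toComplex hα).isOpenMap.image_mem_nhds ((isOpen_Ioo.prod isOpen_Ioo).mem_nhds ?_)
    simp [hr]
  refine (((hg.differentiableOn_toComplex_comp hor hα hball hu hgu).differentiableAt
    hnhds).congr_of_eventuallyEq ?_).differentiableWithinAt
  filter_upwards [hnhds]
  rintro _ ⟨z, hz, rfl⟩
  rw [conjMap_toComplex, Homeomorph.symm_apply_apply,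
    hgu (prod_mono Ioo_subset_Icc_self Ioo_subset_Icc_self hz)]

end Holomorphy

section HolomorphicHomeomorphism

variable {F : OpenPartialHomeomorph ℂ ℂ}

lemma eventually_deriv_ne_zero (hF : DifferentiableOn ℂ F F.source) {w₀ : ℂ}
    (hw₀ : w₀ ∈ F.source) : ∀ᶠ w in 𝓝[≠] w₀, deriv F w ≠ 0 := by
  have hanalytic : AnalyticAt ℂ (deriv F) w₀ :=
    (hF.analyticAt (F.open_source.mem_nhds hw₀)).deriv
  refine hanalytic.eventually_eq_zero_or_eventually_ne_zero.resolve_left fun hzero => ?_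
  obtain ⟨r, hr, hball⟩ := Metric.mem_nhds_iff.1
    (inter_mem hzero (F.open_source.mem_nhds hw₀))
  obtain ⟨c, hc⟩ := Metric.isOpen_ball.exists_is_const_of_deriv_eq_zero
    (convex_ball w₀ r).isPreconnected (hF.mono fun w hw => (hball hw).2)
    fun w hw => (hball hw).1
  have hsub : (Metric.ball w₀ r).Subsingleton := fun w hw w' hw' =>
    F.injOn (hball hw).2 (hball hw').2 ((hc w hw).trans (hc w' hw').symm)
  exact infinite_of_mem_nhds w₀ (Metric.ball_mem_nhds w₀ hr) hsub.finite

theorem differentiableOn_symm (hF : DifferentiableOn ℂ F F.source) :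
    DifferentiableOn ℂ F.symm F.target := by
  intro v₀ hv₀
  refine (Complex.analyticAt_of_differentiable_on_punctured_nhds_of_continuousAt ?_
    (F.symm.continuousAt hv₀)).differentiableAt.differentiableWithinAt
  have htarget : ∀ᶠ v in 𝓝[≠] v₀, v ∈ F.target :=
    mem_nhdsWithin_of_mem_nhds (F.open_target.mem_nhds hv₀)
  have hpunctured : Tendsto F.symm (𝓝[≠] v₀) (𝓝[≠] F.symm v₀) := by
    refine tendsto_nhdsWithin_iff.2
      ⟨(F.symm.continuousAt hv₀).tendsto.mono_left nhdsWithin_le_nhds, ?_⟩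
    filter_upwards [self_mem_nhdsWithin, htarget] with v hv hvt heq
    exact hv (F.symm.injOn hvt hv₀ heq)
  filter_upwards [hpunctured.eventually (eventually_deriv_ne_zero hF (F.map_target hv₀)),
    htarget] with v hv hvt
  have hderiv : HasDerivAt F (deriv F (F.symm v)) (F.symm v) :=
    (hF.differentiableAt (F.open_source.mem_nhds (F.map_target hvt))).hasDerivAt
  exact (F.hasDerivAt_symm hvt hv hderiv).differentiableAt

theorem deriv_ne_zero_of_differentiableOn (hF : DifferentiableOn ℂ F F.source) {w : ℂ}
    (hw : w ∈ F.source) : deriv F w ≠ 0 := by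
  have hderiv : HasDerivAt F (deriv F w) w :=
    (hF.differentiableAt (F.open_source.mem_nhds hw)).hasDerivAt
  have hderiv_symm : HasDerivAt F.symm (deriv F.symm (F w)) (F w) :=
    ((differentiableOn_symm hF).differentiableAt
      (F.open_target.mem_nhds (F.map_source hw))).hasDerivAt
  have hid : HasDerivAt (F.symm ∘ F) 1 w :=
    (hasDerivAt_id w).congr_of_eventuallyEq (F.eventually_left_inverse hw)
  exact right_ne_zero_of_mul_eq_one ((hderiv_symm.comp w hderiv).unique hid)

end HolomorphicHomeomorphism

section MultiplicationMatrix

lemma continuous_leftMulMatrix_basisOneI :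
    Continuous (Algebra.leftMulMatrix Complex.basisOneI) :=
  (Algebra.leftMulMatrix Complex.basisOneI).toLinearMap.continuous_of_finiteDimensional

lemma transpose_leftMulMatrix_basisOneI (w : ℂ) :
    (Algebra.leftMulMatrix Complex.basisOneI w).transpose =
      Algebra.leftMulMatrix Complex.basisOneI (starRingEnd ℂ w) := by
  rw [Algebra.leftMulMatrix_complex, Algebra.leftMulMatrix_complex]
  ext i j
  fin_cases i <;> fin_cases j <;> simp

lemma leftMulMatrix_basisOneI_mem_orthogonalGroup {w : ℂ} (hw : ‖w‖ = 1) :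
    Algebra.leftMulMatrix Complex.basisOneI w ∈ Matrix.orthogonalGroup (Fin 2) ℝ := by
  rw [Matrix.mem_orthogonalGroup_iff, transpose_leftMulMatrix_basisOneI, ← map_mul,
    Complex.mul_conj', hw]
  simp

lemma det_leftMulMatrix_basisOneI (w : ℂ) :
    (Algebra.leftMulMatrix Complex.basisOneI w).det = Complex.normSq w := by
  rw [← Algebra.norm_eq_matrix_det, Algebra.norm_complex_apply]

end MultiplicationMatrix

section ConjDeriv

lemma hasDerivAt_of_powPrimitive_comp {α : ℝ} (hα : 0 ≤ α) {h : ℝ → ℝ} {D t : ℝ}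
    (hD : HasDerivAt (fun s => powPrimitive α (h s)) D t) (hne : h t ≠ 0) :
    HasDerivAt h (D / |h t| ^ α) t := by
  let e := ((strictMono_powPrimitive hα).orderIsoOfSurjective _
    (surjective_powPrimitive hα)).toHomeomorph
  have hleft (x : ℝ) : e.symm (powPrimitive α x) = x := e.symm_apply_apply x
  have hsymm : HasDerivAt e.symm (|h t| ^ α)⁻¹ (powPrimitive α (h t)) := by
    refine HasDerivAt.of_local_left_inverse (f := powPrimitive α)
      e.symm.continuous.continuousAt ?_ (Real.rpow_pos_of_pos (abs_pos.2 hne) _).ne'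
      (Eventually.of_forall e.apply_symm_apply)
    rw [hleft]
    exact hasDerivAt_powPrimitive hα (h t)
  have hcomp := hsymm.comp t hD
  simp only [Function.comp_def, hleft] at hcomp
  rwa [div_eq_inv_mul]

/-- The complex derivative, at the point `z` of the Grushin plane, of `g` read in the coordinates
`toComplex`. -/
noncomputable def conjDeriv {α : ℝ} (hα : 0 ≤ α) (g : OpenPartialHomeomorph (ℝ × ℝ) (ℝ × ℝ))
    (z : ℝ × ℝ) : ℂ :=
  deriv (conjMap hα g) (toComplex hα z)

variable {α : ℝ} {hα : 0 ≤ α} {g : OpenPartialHomeomorph (ℝ × ℝ) (ℝ × ℝ)} {z : ℝ × ℝ}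
  (hF : DifferentiableOn ℂ (conjMap hα g) (conjMap hα g).source)
include hF

lemma continuousOn_conjDeriv : ContinuousOn (conjDeriv hα g) g.source :=
  (hF.deriv (conjMap hα g).open_source).continuousOn.comp (toComplex hα).continuous.continuousOn
    fun _ hz => (toComplex_mem_conjMap_source hα g).2 hz

lemma conjDeriv_ne_zero (hz : z ∈ g.source) : conjDeriv hα g z ≠ 0 :=
  deriv_ne_zero_of_differentiableOn hF ((toComplex_mem_conjMap_source hα g).2 hz)

lemma hasDerivAt_conjMap (hz : z ∈ g.source) :
    HasDerivAt (conjMap hα g) (conjDeriv hα g z) (toComplex hα z) :=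
  (hF.differentiableAt ((conjMap hα g).open_source.mem_nhds
    ((toComplex_mem_conjMap_source hα g).2 hz))).hasDerivAt

lemma hasDerivAt_toComplex_comp_left (hz : z ∈ g.source) :
    HasDerivAt (fun t => toComplex hα (g (t, z.2)))
      (((|z.1| ^ α : ℝ) : ℂ) * conjDeriv hα g z) z.1 := by
  have hline : HasDerivAt (fun t => toComplex hα (t, z.2)) ((|z.1| ^ α : ℝ) : ℂ) z.1 := by
    simp_rw [toComplex_eq]
    exact (hasDerivAt_powPrimitive hα z.1).ofReal_comp.add_const _
  simpa only [Function.comp_def, conjMap_toComplex, smul_eq_mul] using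
    (hasDerivAt_conjMap hF hz).scomp z.1 hline

lemma hasDerivAt_toComplex_comp_right (hz : z ∈ g.source) :
    HasDerivAt (fun t => toComplex hα (g (z.1, t))) (Complex.I * conjDeriv hα g z) z.2 := by
  have hline : HasDerivAt (fun t => toComplex hα (z.1, t)) Complex.I z.2 := by
    simp_rw [toComplex_eq]
    simpa using ((hasDerivAt_id z.2).ofReal_comp.mul_const Complex.I).const_add
      (powPrimitive α z.1 : ℂ)
  simpa only [Function.comp_def, conjMap_toComplex, smul_eq_mul] using
    HasDerivAt.scomp (h := fun t => toComplex hα (z.1, t)) z.2 (hasDerivAt_conjMap hF hz) hline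

lemma hasDerivAt_snd_left (hz : z ∈ g.source) :
    HasDerivAt (fun t => (g (t, z.2)).2) (|z.1| ^ α * (conjDeriv hα g z).im) z.1 := by
  simpa [Complex.im_ofReal_mul, Function.comp_def] using
    Complex.imCLM.hasFDerivAt.comp_hasDerivAt _ (hasDerivAt_toComplex_comp_left hF hz)

lemma hasDerivAt_snd_right (hz : z ∈ g.source) :
    HasDerivAt (fun t => (g (z.1, t)).2) (conjDeriv hα g z).re z.2 := by
  simpa [Function.comp_def] using
    Complex.imCLM.hasFDerivAt.comp_hasDerivAt _ (hasDerivAt_toComplex_comp_right hF hz)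

lemma hasDerivAt_fst_left_of_ne_zero (hz : z ∈ g.source) (hne : (g z).1 ≠ 0) :
    HasDerivAt (fun t => (g (t, z.2)).1)
      (|z.1| ^ α / |(g z).1| ^ α * (conjDeriv hα g z).re) z.1 := by
  have hre : HasDerivAt (fun t => powPrimitive α (g (t, z.2)).1)
      (|z.1| ^ α * (conjDeriv hα g z).re) z.1 := by
    simpa [Complex.re_ofReal_mul, Function.comp_def] using
      Complex.reCLM.hasFDerivAt.comp_hasDerivAt _ (hasDerivAt_toComplex_comp_left hF hz)
  rw [← mul_div_right_comm]
  exact hasDerivAt_of_powPrimitive_comp hα hre hne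

lemma hasDerivAt_fst_right_of_ne_zero (hz : z ∈ g.source) (hne : (g z).1 ≠ 0) :
    HasDerivAt (fun t => (g (z.1, t)).1) (-(conjDeriv hα g z).im / |(g z).1| ^ α) z.2 := by
  have hre : HasDerivAt (fun t => powPrimitive α (g (z.1, t)).1) (-(conjDeriv hα g z).im) z.2 := by
    simpa [Function.comp_def] using
      Complex.reCLM.hasFDerivAt.comp_hasDerivAt _ (hasDerivAt_toComplex_comp_right hF hz)
  exact hasDerivAt_of_powPrimitive_comp hα hre hne

lemma Dα_eq_smul_leftMulMatrix (hz : z ∈ regularSet g.source g) :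
    Dα α g z = (|z.1| ^ α / |(g z).1| ^ α) •
      Algebra.leftMulMatrix Complex.basisOneI (conjDeriv hα g z) := by
  obtain ⟨hzs, -, hne⟩ := mem_regularSet.1 hz
  rw [Dα, X, X, Y, Y, (hasDerivAt_fst_left_of_ne_zero hF hzs hne).deriv,
    (hasDerivAt_fst_right_of_ne_zero hF hzs hne).deriv, (hasDerivAt_snd_left hF hzs).deriv,
    (hasDerivAt_snd_right hF hzs).deriv, Algebra.leftMulMatrix_complex]
  ext i j
  fin_cases i <;> fin_cases j <;> simp <;> ring

end ConjDeriv

section SingularLine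

variable {α : ℝ} {g : OpenPartialHomeomorph (ℝ × ℝ) (ℝ × ℝ)} {z₀ : ℝ × ℝ}

lemma source_subset_closure_regularSet (g : OpenPartialHomeomorph (ℝ × ℝ) (ℝ × ℝ)) :
    g.source ⊆ closure (regularSet g.source g) := by
  have hdense : Dense {z : ℝ × ℝ | z.1 ≠ 0} := Measure.dense_of_ae ae_fst_ne_zero
  have hopen : IsOpen {z : ℝ × ℝ | z.1 ≠ 0} := isOpen_ne.preimage continuous_fst
  intro z₀ hz₀
  rw [mem_closure_iff]
  intro o ho hzo
  have hos : IsOpen (o ∩ g.source) := ho.inter g.open_source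
  have hne : (o ∩ g.source ∩ {z : ℝ × ℝ | z.1 ≠ 0}).Nonempty :=
    hdense.inter_open_nonempty _ hos ⟨z₀, hzo, hz₀⟩
  obtain ⟨_, ⟨z, hz, rfl⟩, hgz⟩ := hdense.inter_open_nonempty _
    (g.isOpen_image_of_subset_source (hos.inter hopen) fun z hz => hz.1.2) (hne.image g)
  exact ⟨z, hz.1.1, mem_regularSet.2 ⟨hz.1.2, hz.2, hgz⟩⟩

/- Both sides extend continuously from the regular set, on which the identity is
`Dα_eq_smul_leftMulMatrix`. -/
lemma abs_rpow_smul_eq_of_tendsto_Dα {hα : 0 ≤ α}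
    (hF : DifferentiableOn ℂ (conjMap hα g) (conjMap hα g).source) (hz₀ : z₀ ∈ g.source)
    {L : Matrix (Fin 2) (Fin 2) ℝ} (hL : Tendsto (Dα α g) (𝓝[regularSet g.source g] z₀) (𝓝 L)) :
    |(g z₀).1| ^ α • L =
      |z₀.1| ^ α • Algebra.leftMulMatrix Complex.basisOneI (conjDeriv hα g z₀) := by
  have : (𝓝[regularSet g.source g] z₀).NeBot :=
    mem_closure_iff_nhdsWithin_neBot.1 (source_subset_closure_regularSet g hz₀)
  have habs : Continuous fun z : ℝ × ℝ => |z.1| ^ α := (continuous_abs_rpow hα).comp continuous_fst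
  have hleft : Tendsto (fun z => |(g z).1| ^ α • Dα α g z) (𝓝[regularSet g.source g] z₀)
      (𝓝 (|(g z₀).1| ^ α • L)) :=
    ((habs.continuousAt.comp (g.continuousAt hz₀)).tendsto.mono_left nhdsWithin_le_nhds).smul hL
  have hconj : ContinuousAt (conjDeriv hα g) z₀ :=
    (continuousOn_conjDeriv hF).continuousAt (g.open_source.mem_nhds hz₀)
  have hright : ContinuousAt (fun z => |z.1| ^ α •
      Algebra.leftMulMatrix Complex.basisOneI (conjDeriv hα g z)) z₀ :=
    habs.continuousAt.smul (continuous_leftMulMatrix_basisOneI.continuousAt.comp hconj)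
  refine tendsto_nhds_unique (hleft.congr' ?_) (hright.tendsto.mono_left nhdsWithin_le_nhds)
  filter_upwards [self_mem_nhdsWithin] with z hz
  have hpos : 0 < |(g z).1| ^ α := Real.rpow_pos_of_pos (abs_pos.2 (mem_regularSet.1 hz).2.2) _
  rw [Dα_eq_smul_leftMulMatrix hF hz, smul_smul, mul_div_cancel₀ _ hpos.ne']

theorem IsSobolevConformal.fst_eq_zero_iff (hg : IsSobolevConformal α g) (hα : 0 < α)
    (hz₀ : z₀ ∈ g.source) : (g z₀).1 = 0 ↔ z₀.1 = 0 := by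
  have habs (x : ℝ) : |x| ^ α = 0 ↔ x = 0 := by
    rw [Real.rpow_eq_zero (abs_nonneg x) hα.ne', abs_eq_zero]
  have hF := hg.2.1.differentiableOn_conjMap hg.1 hα.le
  by_cases hsing : z₀ ∈ singularSet g.source g
  · obtain ⟨L, hL_ne, hL⟩ := hg.2.1.2.2 z₀ hsing
    have hmatrix_ne : Algebra.leftMulMatrix Complex.basisOneI (conjDeriv hα.le g z₀) ≠ 0 :=
      (map_ne_zero_iff _ (Algebra.leftMulMatrix_injective _)).2 (conjDeriv_ne_zero hF hz₀)
    rw [← habs, ← habs z₀.1, ← smul_eq_zero_iff_left hL_ne,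
      abs_rpow_smul_eq_of_tendsto_Dα hF hz₀ hL, smul_eq_zero_iff_left hmatrix_ne]
  · have hnot : ¬(z₀.1 = 0 ∨ (g z₀).1 = 0) := fun h => hsing ⟨hz₀, h⟩
    tauto

end SingularLine

section ContinuousDerivative

lemma hasDerivAt_of_eventually_hasDerivAt {E : Type*} [NormedAddCommGroup E] [NormedSpace ℝ E]
    {f f' : ℝ → E} {x : ℝ} (hd : ∀ᶠ y in 𝓝[≠] x, HasDerivAt f (f' y) y) (hf : ContinuousAt f x)
    (hf' : ContinuousAt f' x) : HasDerivAt f (f' x) x := by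
  have hdiff : DifferentiableOn ℝ f {y | HasDerivAt f (f' y) y} :=
    fun y hy => hy.differentiableAt.differentiableWithinAt
  have hlim : Tendsto (deriv f) (𝓝[≠] x) (𝓝 (f' x)) :=
    (hf'.tendsto.mono_left nhdsWithin_le_nhds).congr' (hd.mono fun y hy => hy.deriv.symm)
  have hright : HasDerivWithinAt f (f' x) (Ici x) x :=
    hasDerivWithinAt_Ici_of_tendsto_deriv hdiff hf.continuousWithinAt (nhdsGT_le_nhdsNE x hd)
      (hlim.mono_left (nhdsGT_le_nhdsNE x))
  have hleft : HasDerivWithinAt f (f' x) (Iic x) x :=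
    hasDerivWithinAt_Iic_of_tendsto_deriv hdiff hf.continuousWithinAt (nhdsLT_le_nhdsNE x hd)
      (hlim.mono_left (nhdsLT_le_nhdsNE x))
  simpa using hleft.union hright

variable {Ω U : Set (ℝ × ℝ)} {e : ℝ × ℝ} {u v φ : ℝ × ℝ → ℝ} {z : ℝ × ℝ}

lemma integrable_mul_of_hasCompactSupport (hu : ContinuousOn u U) (hφ : Continuous φ)
    (hsupp : HasCompactSupport φ) (hφU : tsupport φ ⊆ U) : Integrable fun z => u z * φ z := by
  have hint : IntegrableOn (fun z => u z * φ z) (tsupport φ) :=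
    ((hu.mono hφU).mul hφ.continuousOn).integrableOn_compact hsupp
  exact hint.integrable_of_forall_notMem_eq_zero fun z hz => by
    rw [image_eq_zero_of_notMem_tsupport hz, mul_zero]

lemma hasWeakDerivOn_of_hasLineDerivAt (hU : MeasurableSet U) (hu : ContinuousOn u U)
    (hv : ContinuousOn v U) (h : ∀ z ∈ U, HasLineDerivAt ℝ u (v z) z e) :
    HasWeakDerivOn U e u v := by
  refine ⟨hu.locallyIntegrableOn hU, hv.locallyIntegrableOn hU, fun φ hφ hsupp hφU => ?_⟩
  have hφ'U : tsupport (fun z => fderiv ℝ φ z e) ⊆ U :=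
    (tsupport_fderiv_apply_subset ℝ e).trans hφU
  have hφ' : Continuous fun z => fderiv ℝ φ z e :=
    (hφ.continuous_fderiv (by simp)).clm_apply continuous_const
  rw [setIntegral_mul_eq_integral_of_tsupport_subset hφ'U,
    setIntegral_mul_eq_integral_of_tsupport_subset hφU]
  exact integral_bilinear_hasLineDerivAt_right_eq_neg_left_of_integrable
    (B := ContinuousLinearMap.mul ℝ ℝ)
    (integrable_mul_of_hasCompactSupport hv hφ.continuous hsupp hφU)
    (integrable_mul_of_hasCompactSupport hu hφ' (hsupp.fderiv_apply ℝ e) hφ'U)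
    (integrable_mul_of_hasCompactSupport hu hφ.continuous hsupp hφU)
    (fun z hz => h z (hφU hz))
    (fun z _ => ((hφ.differentiable (by simp)) z).hasFDerivAt.hasLineDerivAt e)

lemma hasLineDerivAt_left {D : ℝ} (h : HasDerivAt (fun t => u (t, z.2)) D z.1) :
    HasLineDerivAt ℝ u D z (1, 0) := by
  rw [← add_zero z.1] at h
  have hline (t : ℝ) : z + t • ((1 : ℝ), (0 : ℝ)) = (z.1 + t, z.2) := by ext <;> simp
  simpa only [HasLineDerivAt, hline] using h.comp_const_add z.1 0

lemma hasLineDerivAt_right {D : ℝ} (h : HasDerivAt (fun t => u (z.1, t)) D z.2) :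
    HasLineDerivAt ℝ u D z (0, 1) := by
  rw [← add_zero z.2] at h
  have hline (t : ℝ) : z + t • ((0 : ℝ), (1 : ℝ)) = (z.1, z.2 + t) := by ext <;> simp
  simpa only [HasLineDerivAt, hline] using h.comp_const_add z.2 0

lemma memLp_restrict_of_continuousOn (hu : ContinuousOn u Ω) (hU : MeasurableSet U)
    (hU_compact : IsCompact (closure U)) (hUΩ : closure U ⊆ Ω) (p : ENNReal) :
    MemLp u p (volume.restrict U) := by
  obtain ⟨C, hC⟩ := hU_compact.exists_bound_of_continuousOn (hu.mono hUΩ)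
  have : IsFiniteMeasure ((volume : Measure (ℝ × ℝ)).restrict U) :=
    isFiniteMeasure_restrict.2
      ((measure_mono subset_closure).trans_lt hU_compact.measure_lt_top).ne
  refine MemLp.of_bound ((hu.mono (subset_closure.trans hUΩ)).aestronglyMeasurable hU) C ?_
  rw [ae_restrict_iff' hU]
  exact Eventually.of_forall fun z hz => hC z (subset_closure hz)

lemma memHW_of_hasDerivAt {α : ℝ} (hα : 0 ≤ α) {ux uy : ℝ × ℝ → ℝ}
    (hu : ContinuousOn u Ω) (hux : ContinuousOn ux Ω) (huy : ContinuousOn uy Ω)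
    (hdx : ∀ z ∈ Ω, HasDerivAt (fun t => u (t, z.2)) (ux z) z.1)
    (hdy : ∀ z ∈ Ω, HasDerivAt (fun t => u (z.1, t)) (uy z) z.2)
    (hU : MeasurableSet U) (hU_compact : IsCompact (closure U)) (hUΩ : closure U ⊆ Ω)
    (p : ENNReal) : MemHW α p U u := by
  have hsub : U ⊆ Ω := subset_closure.trans hUΩ
  have hYu : ContinuousOn (fun z => |z.1| ^ α * uy z) Ω :=
    ((continuous_abs_rpow hα).comp continuous_fst).continuousOn.mul huy
  exact ⟨memLp_restrict_of_continuousOn hu hU hU_compact hUΩ p, ux, uy,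
    hasWeakDerivOn_of_hasLineDerivAt hU (hu.mono hsub) (hux.mono hsub)
      fun z hz => hasLineDerivAt_left (hdx z (hsub hz)),
    hasWeakDerivOn_of_hasLineDerivAt hU (hu.mono hsub) (huy.mono hsub)
      fun z hz => hasLineDerivAt_right (hdy z (hsub hz)),
    memLp_restrict_of_continuousOn hux hU hU_compact hUΩ p,
    memLp_restrict_of_continuousOn hYu hU hU_compact hUΩ p⟩

end ContinuousDerivative

section Converse

/-- In the coordinates `toComplex`, the map `g` is holomorphic, and it maps the singular line
`x = 0`, and nothing else, into the singular line. -/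
structure IsHolomorphicPreservingLine {α : ℝ} (hα : 0 ≤ α)
    (g : OpenPartialHomeomorph (ℝ × ℝ) (ℝ × ℝ)) : Prop where
  differentiableOn : DifferentiableOn ℂ (conjMap hα g) (conjMap hα g).source
  fst_eq_zero_iff : ∀ z ∈ g.source, (g z).1 = 0 ↔ z.1 = 0

/-- The stretching `|Re F(w) / Re w|` of the distance to the line `Re w = 0` by `F`, the map `g`
read in the coordinates `toComplex`, extended to the line by `|F'|`. -/
noncomputable def stretchRatio {α : ℝ} (hα : 0 ≤ α) (g : OpenPartialHomeomorph (ℝ × ℝ) (ℝ × ℝ))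
    (z : ℝ × ℝ) : ℝ :=
  if z.1 = 0 then ‖conjDeriv hα g z‖ else |powPrimitive α (g z).1 / powPrimitive α z.1|

/-- The factor `|x|^α / |g₁|^α` between `Dα α g` and the complex derivative, extended continuously
to the line `x = 0` as a power of `stretchRatio`. -/
noncomputable def conformalFactor {α : ℝ} (hα : 0 ≤ α)
    (g : OpenPartialHomeomorph (ℝ × ℝ) (ℝ × ℝ)) (z : ℝ × ℝ) : ℝ :=
  stretchRatio hα g z ^ (-(α / (α + 1)))

variable {α : ℝ} {hα : 0 ≤ α} {g : OpenPartialHomeomorph (ℝ × ℝ) (ℝ × ℝ)} {z z₀ : ℝ × ℝ}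

lemma tendsto_zero_prodMk_snd (hline : z₀.1 = 0) :
    Tendsto (fun z : ℝ × ℝ => ((0 : ℝ), z.2)) (𝓝 z₀) (𝓝 z₀) :=
  Continuous.tendsto' (by fun_prop) _ _ (Prod.ext hline.symm rfl)

lemma tendsto_toComplex_prodMk (hα : 0 ≤ α) (hline : z₀.1 = 0) :
    Tendsto (fun z => (toComplex hα z, toComplex hα (0, z.2))) (𝓝 z₀)
      (𝓝 (toComplex hα z₀, toComplex hα z₀)) :=
  ((toComplex hα).continuous.tendsto z₀).prodMk_nhds
    (((toComplex hα).continuous.tendsto z₀).comp (tendsto_zero_prodMk_snd hline))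

lemma toComplex_sub_toComplex_zero (hα : 0 ≤ α) (z : ℝ × ℝ) :
    toComplex hα z - toComplex hα (0, z.2) = (powPrimitive α z.1 : ℂ) := by
  apply Complex.ext <;> simp

namespace IsHolomorphicPreservingLine

variable (h : IsHolomorphicPreservingLine hα g)
include h

lemma fst_ne_zero (hz : z ∈ g.source) (hx : z.1 ≠ 0) : (g z).1 ≠ 0 :=
  (h.fst_eq_zero_iff z hz).not.2 hx

lemma mem_regularSet (hz : z ∈ g.source) (hx : z.1 ≠ 0) : z ∈ regularSet g.source g :=
  Grushin.mem_regularSet.2 ⟨hz, hx, h.fst_ne_zero hz hx⟩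

lemma continuousAt_conjDeriv (hz : z ∈ g.source) : ContinuousAt (conjDeriv hα g) z :=
  (continuousOn_conjDeriv h.differentiableOn).continuousAt (g.open_source.mem_nhds hz)

lemma analyticAt_conjMap (hz : z ∈ g.source) : AnalyticAt ℂ (conjMap hα g) (toComplex hα z) :=
  h.differentiableOn.analyticAt ((conjMap hα g).open_source.mem_nhds
    ((toComplex_mem_conjMap_source hα g).2 hz))

lemma eventually_fst_eq_zero (hz : z ∈ g.source) (hline : z.1 = 0) :
    ∀ᶠ t in 𝓝 z.2, (g (z.1, t)).1 = 0 := by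
  have hcont : Tendsto (fun t : ℝ => (z.1, t)) (𝓝 z.2) (𝓝 z) :=
    Continuous.tendsto' (by fun_prop) _ _ rfl
  filter_upwards [hcont (g.open_source.mem_nhds hz)] with t ht
  exact (h.fst_eq_zero_iff _ ht).2 hline

lemma im_conjDeriv_eq_zero (hz : z ∈ g.source) (hline : z.1 = 0) :
    (conjDeriv hα g z).im = 0 := by
  have hre : HasDerivAt (fun t => powPrimitive α (g (z.1, t)).1) (-(conjDeriv hα g z).im) z.2 := by
    simpa [Function.comp_def] using Complex.reCLM.hasFDerivAt.comp_hasDerivAt _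
      (hasDerivAt_toComplex_comp_right h.differentiableOn hz)
  have hconst : (fun t => powPrimitive α (g (z.1, t)).1) =ᶠ[𝓝 z.2] fun _ => 0 := by
    filter_upwards [h.eventually_fst_eq_zero hz hline] with t ht
    rw [ht, powPrimitive_zero]
  exact neg_eq_zero.1 (hre.unique ((hasDerivAt_const z.2 0).congr_of_eventuallyEq hconst))

lemma isLittleO_powPrimitive_fst (hz₀ : z₀ ∈ g.source) (hline : z₀.1 = 0) :
    (fun z : ℝ × ℝ => powPrimitive α (g z).1 - powPrimitive α z.1 * (conjDeriv hα g z₀).re)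
      =o[𝓝 z₀] fun z => powPrimitive α z.1 := by
  have hstrict := (h.analyticAt_conjMap hz₀).hasStrictDerivAt.isLittleO.comp_tendsto
    (tendsto_toComplex_prodMk hα hline)
  simp only [Function.comp_def, toComplex_sub_toComplex_zero, conjMap_toComplex,
    ContinuousLinearMap.toSpanSingleton_apply, smul_eq_mul, Complex.isLittleO_ofReal_right]
    at hstrict
  refine Asymptotics.IsBigO.trans_isLittleO (Asymptotics.IsBigO.of_bound' ?_) hstrict
  filter_upwards [tendsto_zero_prodMk_snd hline (g.open_source.mem_nhds hz₀)] with z hz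
  refine le_trans (le_of_eq ?_) (Complex.abs_re_le_norm _)
  have hzero : (g (0, z.2)).1 = 0 := (h.fst_eq_zero_iff _ hz).2 rfl
  simp [hzero, conjDeriv]

lemma tendsto_powPrimitive_div (hz₀ : z₀ ∈ g.source) (hline : z₀.1 = 0) :
    Tendsto (fun z => powPrimitive α (g z).1 / powPrimitive α z.1) (𝓝[{z | z.1 ≠ 0}] z₀)
      (𝓝 (conjDeriv hα g z₀).re) := by
  have hdiv := ((h.isLittleO_powPrimitive_fst hz₀ hline).tendsto_div_nhds_zero.mono_left
    (nhdsWithin_le_nhds (s := {z : ℝ × ℝ | z.1 ≠ 0}))).add_const (conjDeriv hα g z₀).re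
  rw [zero_add] at hdiv
  refine hdiv.congr' ?_
  filter_upwards [self_mem_nhdsWithin] with z hz
  rw [sub_div, mul_div_cancel_left₀ _ ((powPrimitive_eq_zero hα).not.2 hz), sub_add_cancel]

lemma stretchRatio_pos (hz : z ∈ g.source) : 0 < stretchRatio hα g z := by
  rw [stretchRatio]
  split_ifs with hx
  · exact norm_pos_iff.2 (conjDeriv_ne_zero h.differentiableOn hz)
  · exact abs_pos.2 (div_ne_zero ((powPrimitive_eq_zero hα).not.2 (h.fst_ne_zero hz hx))
      ((powPrimitive_eq_zero hα).not.2 hx))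

lemma continuousAt_stretchRatio (hz₀ : z₀ ∈ g.source) :
    ContinuousAt (stretchRatio hα g) z₀ := by
  by_cases hx : z₀.1 = 0
  · have hvalue : stretchRatio hα g z₀ = ‖conjDeriv hα g z₀‖ := if_pos hx
    rw [ContinuousAt, hvalue]
    refine Tendsto.if ((h.continuousAt_conjDeriv hz₀).norm.tendsto.mono_left inf_le_left) ?_
    rw [← Complex.abs_re_eq_norm.2 (h.im_conjDeriv_eq_zero hz₀ hx)]
    exact (h.tendsto_powPrimitive_div hz₀ hx).abs
  · have hP := continuous_powPrimitive hα
    have hquot : ContinuousAt (fun z => |powPrimitive α (g z).1 / powPrimitive α z.1|) z₀ :=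
      ((hP.continuousAt.comp (g.continuousAt hz₀).fst).div (hP.comp continuous_fst).continuousAt
        ((powPrimitive_eq_zero hα).not.2 hx)).abs
    refine hquot.congr ?_
    filter_upwards [continuous_fst.continuousAt.eventually_ne hx] with z hz
    exact (if_neg hz).symm

lemma conformalFactor_pos (hz : z ∈ g.source) : 0 < conformalFactor hα g z :=
  Real.rpow_pos_of_pos (h.stretchRatio_pos hz) _

lemma continuousAt_conformalFactor (hz : z ∈ g.source) :
    ContinuousAt (conformalFactor hα g) z :=
  (h.continuousAt_stretchRatio hz).rpow_const (Or.inl (h.stretchRatio_pos hz).ne')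

lemma conformalFactor_eq (hz : z ∈ g.source) (hx : z.1 ≠ 0) :
    conformalFactor hα g z = |z.1| ^ α / |(g z).1| ^ α := by
  have hα1 : 0 < α + 1 := by positivity
  have hx_pos : 0 < |z.1| := abs_pos.2 hx
  have hg_pos : 0 < |(g z).1| := abs_pos.2 (h.fst_ne_zero hz hx)
  have hratio : stretchRatio hα g z = (|z.1| / |(g z).1|) ^ (-(α + 1)) := by
    rw [stretchRatio, if_neg hx, abs_div, abs_powPrimitive hα, abs_powPrimitive hα,
      div_div_div_cancel_right₀ hα1.ne', Real.rpow_neg (by positivity), Real.div_rpow hx_pos.le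
      hg_pos.le, inv_div]
  have hexponent : -(α + 1) * -(α / (α + 1)) = α := by field_simp
  rw [conformalFactor, hratio, ← Real.rpow_mul (by positivity), hexponent,
    Real.div_rpow hx_pos.le hg_pos.le]

lemma continuousAt_conformalFactor_mul_re (hz : z ∈ g.source) :
    ContinuousAt (fun z => conformalFactor hα g z * (conjDeriv hα g z).re) z :=
  (h.continuousAt_conformalFactor hz).mul
    (Complex.continuous_re.continuousAt.comp (h.continuousAt_conjDeriv hz))

lemma hasDerivAt_fst_left (hz : z ∈ g.source) :
    HasDerivAt (fun t => (g (t, z.2)).1) (conformalFactor hα g z * (conjDeriv hα g z).re) z.1 := by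
  have off_line (w : ℝ × ℝ) (hw : w ∈ g.source) (hx : w.1 ≠ 0) : HasDerivAt
      (fun t => (g (t, w.2)).1) (conformalFactor hα g w * (conjDeriv hα g w).re) w.1 := by
    rw [h.conformalFactor_eq hw hx]
    exact hasDerivAt_fst_left_of_ne_zero h.differentiableOn hw (h.fst_ne_zero hw hx)
  by_cases hx : z.1 = 0
  · have hline : ContinuousAt (fun t : ℝ => (t, z.2)) z.1 := by fun_prop
    refine hasDerivAt_of_eventually_hasDerivAt
      (f' := fun t => conformalFactor hα g (t, z.2) * (conjDeriv hα g (t, z.2)).re) ?_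
      ((g.continuousAt hz).fst.comp_of_eq hline rfl)
      ((h.continuousAt_conformalFactor_mul_re hz).comp_of_eq hline rfl)
    filter_upwards [self_mem_nhdsWithin,
      mem_nhdsWithin_of_mem_nhds (hline (g.open_source.mem_nhds hz))] with t ht hts
    exact off_line (t, z.2) hts (hx ▸ ht)
  · exact off_line z hz hx

lemma hasDerivAt_fst_right (hz : z ∈ g.source) :
    HasDerivAt (fun t => (g (z.1, t)).1) (-(conjDeriv hα g z).im / |(g z).1| ^ α) z.2 := by
  by_cases hx : z.1 = 0
  · rw [h.im_conjDeriv_eq_zero hz hx, neg_zero, zero_div]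
    exact (hasDerivAt_const z.2 0).congr_of_eventuallyEq (h.eventually_fst_eq_zero hz hx)
  · exact hasDerivAt_fst_right_of_ne_zero h.differentiableOn hz (h.fst_ne_zero hz hx)

lemma isBigO_im_conjDeriv (hz₀ : z₀ ∈ g.source) (hline : z₀.1 = 0) :
    (fun z => (conjDeriv hα g z).im) =O[𝓝 z₀] fun z : ℝ × ℝ => powPrimitive α z.1 := by
  have hstrict := (h.analyticAt_conjMap hz₀).deriv.hasStrictDerivAt.hasStrictFDerivAt.isBigO_sub
    |>.comp_tendsto (tendsto_toComplex_prodMk hα hline)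
  simp only [Function.comp_def, toComplex_sub_toComplex_zero, Complex.isBigO_ofReal_right]
    at hstrict
  refine Asymptotics.IsBigO.trans (Asymptotics.IsBigO.of_bound' ?_) hstrict
  filter_upwards [tendsto_zero_prodMk_snd hline (g.open_source.mem_nhds hz₀)] with z hz
  have hzero : (deriv (conjMap hα g) (toComplex hα (0, z.2))).im = 0 :=
    h.im_conjDeriv_eq_zero hz rfl
  refine le_trans (le_of_eq ?_) (Complex.abs_im_le_norm _)
  rw [Complex.sub_im, hzero, sub_zero, conjDeriv, Real.norm_eq_abs]

/- The quotient is `O(|powPrimitive α x| / |g₁|^α)`, that is, `O(|x|)` times the bounded conformal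
factor. -/
lemma tendsto_im_conjDeriv_div (hz₀ : z₀ ∈ g.source) (hline : z₀.1 = 0) :
    Tendsto (fun z => -(conjDeriv hα g z).im / |(g z).1| ^ α) (𝓝 z₀) (𝓝 0) := by
  obtain ⟨C, hC⟩ := (h.isBigO_im_conjDeriv hz₀ hline).bound
  have hlim : Tendsto (fun z : ℝ × ℝ => C * (conformalFactor hα g z * |z.1| / (α + 1)))
      (𝓝 z₀) (𝓝 0) := by
    have hcont : ContinuousAt
        (fun z : ℝ × ℝ => C * (conformalFactor hα g z * |z.1| / (α + 1))) z₀ :=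
      (((h.continuousAt_conformalFactor hz₀).mul
        (continuous_abs.comp continuous_fst).continuousAt).div_const _).const_mul C
    simpa [hline] using hcont.tendsto
  refine squeeze_zero_norm' ?_ hlim
  filter_upwards [hC, g.open_source.mem_nhds hz₀] with z hbound hz
  by_cases hx : z.1 = 0
  · simp [h.im_conjDeriv_eq_zero hz hx, hx]
  · have hpos : 0 < |(g z).1| ^ α := Real.rpow_pos_of_pos (abs_pos.2 (h.fst_ne_zero hz hx)) _
    calc ‖-(conjDeriv hα g z).im / |(g z).1| ^ α‖
        = ‖(conjDeriv hα g z).im‖ / |(g z).1| ^ α := by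
          rw [norm_div, norm_neg, Real.norm_of_nonneg hpos.le]
      _ ≤ C * ‖powPrimitive α z.1‖ / |(g z).1| ^ α := by gcongr
      _ = C * (conformalFactor hα g z * |z.1| / (α + 1)) := by
          rw [h.conformalFactor_eq hz hx, Real.norm_eq_abs, abs_powPrimitive hα,
            Real.rpow_add_one (abs_pos.2 hx).ne']
          ring

lemma continuousAt_im_conjDeriv_div (hz₀ : z₀ ∈ g.source) :
    ContinuousAt (fun z => -(conjDeriv hα g z).im / |(g z).1| ^ α) z₀ := by
  by_cases hx : z₀.1 = 0
  · have hvalue : -(conjDeriv hα g z₀).im / |(g z₀).1| ^ α = 0 := by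
      rw [h.im_conjDeriv_eq_zero hz₀ hx, neg_zero, zero_div]
    rw [ContinuousAt, hvalue]
    exact h.tendsto_im_conjDeriv_div hz₀ hx
  · exact (Complex.continuous_im.continuousAt.comp (h.continuousAt_conjDeriv hz₀)).neg.div
      ((continuous_abs_rpow hα).continuousAt.comp (g.continuousAt hz₀).fst)
      (Real.rpow_pos_of_pos (abs_pos.2 (h.fst_ne_zero hz₀ hx)) _).ne'

theorem memHWLocMap (p : ENNReal) : MemHWLocMap α p g.source g.target g := by
  have hF := h.differentiableOn
  have hF' := continuousOn_conjDeriv hF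
  refine ⟨g.mapsTo, fun U hU hU_compact hUs =>
    ⟨g.mapsTo.mono_left (subset_closure.trans hUs), ?_, ?_⟩⟩
  · exact memHW_of_hasDerivAt hα (continuous_fst.comp_continuousOn g.continuousOn)
      (fun z hz => (h.continuousAt_conformalFactor_mul_re hz).continuousWithinAt)
      (fun z hz => (h.continuousAt_im_conjDeriv_div hz).continuousWithinAt)
      (fun z hz => h.hasDerivAt_fst_left hz) (fun z hz => h.hasDerivAt_fst_right hz)
      hU.measurableSet hU_compact hUs p
  · exact memHW_of_hasDerivAt hα (continuous_snd.comp_continuousOn g.continuousOn)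
      (((continuous_abs_rpow hα).comp continuous_fst).continuousOn.mul
        (Complex.continuous_im.comp_continuousOn hF'))
      (Complex.continuous_re.comp_continuousOn hF')
      (fun z hz => hasDerivAt_snd_left hF hz) (fun z hz => hasDerivAt_snd_right hF hz)
      hU.measurableSet hU_compact hUs p

lemma Dα_eq_conformalFactor_smul (hz : z ∈ g.source) (hx : z.1 ≠ 0) :
    Dα α g z = conformalFactor hα g z •
      Algebra.leftMulMatrix Complex.basisOneI (conjDeriv hα g z) := by
  rw [h.conformalFactor_eq hz hx,
    Dα_eq_smul_leftMulMatrix h.differentiableOn (h.mem_regularSet hz hx)]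

lemma det_DH_pos (hz : z ∈ g.source) (hx : z.1 ≠ 0) : 0 < (DH α g z).det := by
  have hpos : 0 < |(g z).1| ^ α := Real.rpow_pos_of_pos (abs_pos.2 (h.fst_ne_zero hz hx)) _
  have hκ := h.conformalFactor_pos hz
  have hnorm := Complex.normSq_pos.2 (conjDeriv_ne_zero h.differentiableOn hz)
  rw [← div_pos_iff_of_pos_right hpos, ← det_Dα, h.Dα_eq_conformalFactor_smul hz hx,
    Matrix.det_smul, det_leftMulMatrix_basisOneI]
  positivity

lemma orientationPreserving : OrientationPreserving α g.source g.target g := by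
  refine ⟨h.memHWLocMap 1, (ae_restrict_iff' g.open_source.measurableSet).2 ?_⟩
  filter_upwards [ae_fst_ne_zero] with z hx hz using h.det_DH_pos hz hx

lemma exists_Dα_eq_smul_orthogonal (hz : z ∈ g.source) (hx : z.1 ≠ 0) :
    ∃ r : ℝ, 0 < r ∧ ∃ O ∈ Matrix.orthogonalGroup (Fin 2) ℝ, Dα α g z = r • O := by
  set w := conjDeriv hα g z
  have hw_pos : 0 < ‖w‖ := norm_pos_iff.2 (conjDeriv_ne_zero h.differentiableOn hz)
  have hunit : ‖‖w‖⁻¹ • w‖ = 1 := by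
    rw [norm_smul, norm_inv, norm_norm, inv_mul_cancel₀ hw_pos.ne']
  refine ⟨conformalFactor hα g z * ‖w‖, mul_pos (h.conformalFactor_pos hz) hw_pos, _,
    leftMulMatrix_basisOneI_mem_orthogonalGroup hunit, ?_⟩
  rw [h.Dα_eq_conformalFactor_smul hz hx, map_smul, smul_smul, mul_assoc,
    mul_inv_cancel₀ hw_pos.ne', mul_one]

lemma exists_tendsto_Dα (hz₀ : z₀ ∈ g.source) :
    ∃ L : Matrix (Fin 2) (Fin 2) ℝ, L ≠ 0 ∧
      Tendsto (Dα α g) (𝓝[regularSet g.source g] z₀) (𝓝 L) := by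
  refine ⟨conformalFactor hα g z₀ • Algebra.leftMulMatrix Complex.basisOneI (conjDeriv hα g z₀),
    smul_ne_zero (h.conformalFactor_pos hz₀).ne' ((map_ne_zero_iff _
      (Algebra.leftMulMatrix_injective _)).2 (conjDeriv_ne_zero h.differentiableOn hz₀)), ?_⟩
  have hcont : ContinuousAt (fun z => conformalFactor hα g z •
      Algebra.leftMulMatrix Complex.basisOneI (conjDeriv hα g z)) z₀ :=
    (h.continuousAt_conformalFactor hz₀).smul
      (continuous_leftMulMatrix_basisOneI.continuousAt.comp (h.continuousAt_conjDeriv hz₀))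
  refine (hcont.tendsto.mono_left nhdsWithin_le_nhds).congr' ?_
  filter_upwards [self_mem_nhdsWithin] with z hz
  obtain ⟨hzs, hx, -⟩ := Grushin.mem_regularSet.1 hz
  exact (h.Dα_eq_conformalFactor_smul hzs hx).symm

theorem isConformal : IsConformal α g := by
  refine ⟨h.memHWLocMap 2, (ae_restrict_iff' (isOpen_regularSet g).measurableSet).2 ?_,
    fun z₀ hz₀ => h.exists_tendsto_Dα hz₀.1⟩
  refine Eventually.of_forall fun z hz => ?_
  obtain ⟨hzs, hx, -⟩ := Grushin.mem_regularSet.1 hz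
  exact h.exists_Dα_eq_smul_orthogonal hzs hx

theorem isSobolevConformal : IsSobolevConformal α g :=
  ⟨h.orientationPreserving, h.isConformal, h.memHWLocMap _⟩

end IsHolomorphicPreservingLine

end Converse

section ConformalMaps

variable {α : ℝ} {g h : OpenPartialHomeomorph (ℝ × ℝ) (ℝ × ℝ)}

theorem isSobolevConformal_iff (hα : 0 < α) :
    IsSobolevConformal α g ↔ IsHolomorphicPreservingLine hα.le g :=
  ⟨fun hg => ⟨hg.2.1.differentiableOn_conjMap hg.1 hα.le, fun _ hz => hg.fst_eq_zero_iff hα hz⟩,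
    fun hg => hg.isSobolevConformal⟩

lemma IsHolomorphicPreservingLine.symm {hα : 0 ≤ α} (hg : IsHolomorphicPreservingLine hα g) :
    IsHolomorphicPreservingLine hα g.symm where
  differentiableOn := by
    rw [conjMap_symm]
    exact differentiableOn_symm hg.differentiableOn
  fst_eq_zero_iff z hz := by
    rw [← hg.fst_eq_zero_iff _ (g.map_target hz), g.right_inv hz]

lemma IsHolomorphicPreservingLine.trans {hα : 0 ≤ α} (hh : IsHolomorphicPreservingLine hα h)
    (hg : IsHolomorphicPreservingLine hα g) : IsHolomorphicPreservingLine hα (h.trans g) where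
  differentiableOn := by
    rw [conjMap_trans]
    exact hg.differentiableOn.comp (hh.differentiableOn.mono inter_subset_left) fun _ hw => hw.2
  fst_eq_zero_iff z hz :=
    (hg.fst_eq_zero_iff (h z) hz.2).trans (hh.fst_eq_zero_iff z hz.1)

lemma toComplex_dilation (hα : 0 ≤ α) {r : ℝ} (hr : 0 < r) (z : ℝ × ℝ) :
    toComplex hα (dilation α r hr z) = ((r ^ (α + 1) : ℝ) : ℂ) * toComplex hα z := by
  apply Complex.ext
  · rw [Complex.re_ofReal_mul, toComplex_re, toComplex_re]
    exact powPrimitive_mul hr α z.1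
  · rw [Complex.im_ofReal_mul, toComplex_im, toComplex_im]
    rfl

lemma isHolomorphicPreservingLine_dilation (hα : 0 ≤ α) {r : ℝ} (hr : 0 < r) :
    IsHolomorphicPreservingLine hα (dilation α r hr).toOpenPartialHomeomorph where
  differentiableOn := by
    refine ((differentiable_id.const_mul ((r ^ (α + 1) : ℝ) : ℂ)).differentiableOn).congr ?_
    intro w _
    obtain ⟨z, rfl⟩ := (toComplex hα).surjective w
    rw [conjMap_toComplex]
    exact toComplex_dilation hα hr z
  fst_eq_zero_iff z _ := by
    change r * z.1 = 0 ↔ z.1 = 0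
    simp only [mul_eq_zero, hr.ne', false_or]

end ConformalMaps

end Grushin

theorem mainTheorem3 (α : ℝ) (hα : 0 < α)
    (g h : OpenPartialHomeomorph (ℝ × ℝ) (ℝ × ℝ))
    (hg : Grushin.IsSobolevConformal α g) (hh : Grushin.IsSobolevConformal α h) :
    -- `h.trans g` is `g ∘ h` on `{z ∈ h.source | h z ∈ g.source}`
    (Grushin.IsSobolevConformal α (h.trans g) ∧ Grushin.IsSobolevConformal α (g.trans h)) ∧
    (Grushin.IsSobolevConformal α g.symm ∧ Grushin.IsSobolevConformal α h.symm) ∧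
    ∀ (r : ℝ) (hr : 0 < r),
      Grushin.IsSobolevConformal α
        ((Grushin.dilation α r hr).toOpenPartialHomeomorph.trans g) ∧
      Grushin.IsSobolevConformal α
        (g.trans (Grushin.dilation α r hr).toOpenPartialHomeomorph) := by
  simp only [Grushin.isSobolevConformal_iff hα] at hg hh ⊢
  exact ⟨⟨hh.trans hg, hg.trans hh⟩, ⟨hg.symm, hh.symm⟩, fun r hr =>
    ⟨(Grushin.isHolomorphicPreservingLine_dilation hα.le hr).trans hg,
      hg.trans (Grushin.isHolomorphicPreservingLine_dilation hα.le hr)⟩⟩
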